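/- A strict partition $\bar\lambda=(\bar\lambda_1>\bar\lambda_2>\cdots>\bar\lambda_\ell>0)$ has size $|\bar\lambda|=\sum_i\bar\lambda_i$ and length $\ell(\bar\lambda)=\ell$, and we put $\bar\lambda_i=0$ for $i>\ell$. Its shifted Young diagram has the boxes $(i,j)$ with $1\le i\le\ell$ and $i+1\le j\le i+\bar\lambda_i$; the box $(i,j)$ has content $j-i$, and its hook length is the number of boxes to its right in row $i$, plus the number of boxes of column $j$ in rows below row $i$, plus $1$, plus $\bar\lambda_j$. Let $H(\bar\lambda)$ be the product of the hook lengths of all boxes of the shifted diagram. The doubled distinct partition $\bar\lambda\bar\lambda$ is the usual partition whose Young diagram is obtained from the shifted diagram by adding $\bar\lambda_i$ boxes to the $i$-th column for $1\le i\le\ell$; let $\mathcal H(\bar\lambda\bar\lambda)$ be the multiset of its (usual) hook lengths. For a usual partition $\delta=(\delta_1,\dots,\delta_{\ell(\delta)})$ put $$p^\delta(\bar\lambda)=\prod_{j=1}^{\ell(\delta)}\ \sum_{h\in\mathcal H(\bar\lambda\bar\lambda)}h^{2\delta_j}.$$ Let $y_1<\dots<y_m$ be the contents of the boxes that can be removed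 from the shifted diagram so that the shifted diagram of a strict partition remains. Let $x_0=1$, and let $x_1<\dots<x_m$ be the contents of the boxes that can be added at the end of one of the rows $1,\dots,\ell$ so that the result is the shifted diagram of a strict partition; for $1\le i\le m$ let $\bar\lambda^{i+}$ be the strict partition obtained by adding the box of content $x_i$. Let $\bar\lambda^{0+}$ be the strict partition obtained by adding a new row with one box (of content $x_0=1$); it exists if and only if $1$ is not a part of $\bar\lambda$. For a usual partition $\nu$ put $$\Phi^\nu(\bar\lambda)=\prod_{j=1}^{\ell(\nu)}\Bigl(\sum_{i=0}^m\tbinom{x_i}{2}^{\nu_j}-\sum_{i=1}^m\tbinom{y_i}{2}^{\nu_j}\Bigr).$$ For a function $g$ from strict partitions to $\mathbb Q$ define the function $\bar D g$ by $$\bar D g(\bar\lambda)=2\sum_{i=1}^m g(\bar\lambda^{i+})+g(\bar\lambda^{0+})-g(\bar\lambda),$$ where $g(\bar\lambda^{0+})$ is read as $0$ if $\bar\lambda^{0+}$ does not exist. For strict partitions $\bar\lambda\supseteq\bar\mu$ (that is, $\bar\lambda_i\ge\bar\mu_i$ for all $i$), let $|\bar\lambda/\bar\mu|=|\bar\lambda|-|\bar\mu|$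 and let $f_{\bar\lambda/\bar\mu}$ be the number of standard shifted Young tableaux of skew shape $\bar\lambda/\bar\mu$. **Theorem.** Let $\nu$ and $\delta$ be usual partitions (possibly empty), and put $r=|\delta|+\ell(\delta)+|\nu|+1$. Then $$\bar D^r\Bigl(\frac{p^\delta(\bar\lambda)\,\Phi^\nu(\bar\lambda)}{H(\bar\lambda)}\Bigr)=0$$ for every strict partition $\bar\lambda$. Moreover, for every strict partition $\bar\mu$, the sum $$\sum_{\bar\lambda\supseteq\bar\mu,\ |\bar\lambda/\bar\mu|=n}\frac{2^{|\bar\lambda|-\ell(\bar\lambda)}f_{\bar\lambda/\bar\mu}}{H(\bar\lambda)}\,p^\delta(\bar\lambda)\qquad(n=0,1,2,\dots)$$ is a polynomial in $n$ of degree at most $|\delta|+\ell(\delta)$. -/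

import Mathlib

/-- The sequence `a 0, a 1, a 2, …` is a strictly decreasing finite sequence of positive integers,
continued by zeros. -/
def IsStrictSeq (a : ℕ →₀ ℕ) : Prop :=
  ∀ i, (0 < a i → a (i + 1) < a i) ∧ (a i = 0 → a (i + 1) = 0)

/-- A strict partition. Parts are numbered from `0`: `part i` is the `(i + 1)`-st largest part, and
`part i = 0` when `i` is at least the length. -/
@[ext]
structure StrictPartition where
  part : ℕ →₀ ℕ
  isStrict : IsStrictSeq part

/-- The arm of the box `c` in a diagram: the boxes of the same row strictly to its right. -/
def diagramArm (cells : Finset (ℕ × ℕ)) (c : ℕ × ℕ) : ℕ :=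
  (cells.filter fun d => d.1 = c.1 ∧ c.2 < d.2).card

/-- The leg of the box `c` in a diagram: the boxes of the same column strictly below it
(that is, with a larger row index). -/
def diagramLeg (cells : Finset (ℕ × ℕ)) (c : ℕ × ℕ) : ℕ :=
  (cells.filter fun d => d.2 = c.2 ∧ c.1 < d.1).card

/-- The hook length of a box in the Young diagram of a usual partition. -/
def YoungDiagram.hook (Y : YoungDiagram) (c : ℕ × ℕ) : ℕ :=
  diagramArm Y.cells c + diagramLeg Y.cells c + 1

/-- The content `column - row` of a box; it is only used for boxes of shifted diagrams, which lie
strictly to the right of the main diagonal, so the subtraction is never truncated. -/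
def boxContent (c : ℕ × ℕ) : ℕ := c.2 - c.1

namespace StrictPartition

variable (lam mu : StrictPartition)

/-- The size `|λ|`, the sum of the parts. -/
def size : ℕ := ∑ i ∈ lam.part.support, lam.part i

/-- The length `ℓ(λ)`, the number of (nonzero) parts. -/
def length : ℕ := lam.part.support.card

/-- The shifted Young diagram. Rows and columns are numbered from `0`; row `i` has `λ_i` boxes and
starts in column `i + 1` (so the leftmost box of each row has content `1`). -/
def cells : Finset (ℕ × ℕ) :=
  lam.part.support.biUnion fun i => {i} ×ˢ Finset.Ioc i (i + lam.part i)

/-- The boxes that are added to the shifted diagram to form the doubled distinct partition: for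
each part `λ_j`, one adds `λ_j` boxes to column `j`, below the `j` boxes of the shifted diagram
in that column (rows `0, …, j - 1`). -/
def doublingCells : Finset (ℕ × ℕ) :=
  lam.part.support.biUnion fun j => Finset.Ico j (j + lam.part j) ×ˢ {j}

theorem mem_cells {lam : StrictPartition} {c : ℕ × ℕ} :
    c ∈ lam.cells ↔ c.1 < c.2 ∧ c.2 ≤ c.1 + lam.part c.1 := by
  obtain ⟨i, j⟩ := c
  simp only [cells, Finset.mem_biUnion, Finset.mem_product, Finset.mem_singleton, Finset.mem_Ioc,
    Finsupp.mem_support_iff]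
  constructor
  · rintro ⟨k, _, rfl, h⟩
    exact h
  · intro h
    exact ⟨i, by omega, rfl, h⟩

theorem mem_doublingCells {lam : StrictPartition} {c : ℕ × ℕ} :
    c ∈ lam.doublingCells ↔ c.2 ≤ c.1 ∧ c.1 < c.2 + lam.part c.2 := by
  obtain ⟨i, j⟩ := c
  simp only [doublingCells, Finset.mem_biUnion, Finset.mem_product, Finset.mem_singleton,
    Finset.mem_Ico, Finsupp.mem_support_iff]
  constructor
  · rintro ⟨k, _, h, rfl⟩
    exact h
  · intro h
    exact ⟨j, by omega, h, rfl⟩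

theorem add_part_le {lam : StrictPartition} {i j : ℕ} (hij : i ≤ j) (hj : 0 < lam.part j) :
    j + lam.part j ≤ i + lam.part i := by
  induction j, hij using Nat.le_induction with
  | base => exact le_rfl
  | succ k _ ih =>
    have h := lam.isStrict k
    rcases Nat.eq_zero_or_pos (lam.part k) with h0 | h0
    · have := h.2 h0
      omega
    · have := h.1 h0
      have := ih h0
      omega

/-- The doubled distinct partition `λλ`, as a Young diagram. -/
def doubled : YoungDiagram where
  cells := lam.cells ∪ lam.doublingCells
  isLowerSet := by
    rintro ⟨i, j⟩ ⟨i', j'⟩ ⟨hi, hj⟩ h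
    simp only [Finset.coe_union, Set.mem_union, Finset.mem_coe, mem_cells, mem_doublingCells]
      at h hi hj ⊢
    rcases h with ⟨h1, h2⟩ | ⟨h1, h2⟩
    · have key : ∀ k ≤ i, i + lam.part i ≤ k + lam.part k :=
        fun k hk => add_part_le hk (by omega)
      rcases lt_or_ge i' j' with h' | h'
      · have := key i' hi
        omega
      · have := key j' (by omega)
        omega
    · have key : ∀ k ≤ j, j + lam.part j ≤ k + lam.part k :=
        fun k hk => add_part_le hk (by omega)
      rcases lt_or_ge i' j' with h' | h'
      · have := key i' (by omega)
        omega
      · have := key j' hj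
        omega

/-- The hook length of the box `(i, j)` of the shifted diagram: the number of boxes to its right,
plus those below it, plus one for the box itself, plus the part `λ_j`. -/
def hook (c : ℕ × ℕ) : ℕ :=
  diagramArm lam.cells c + diagramLeg lam.cells c + 1 + lam.part c.2

/-- `H(λ)`, the product of all hook lengths of the shifted diagram. -/
def hookProd : ℕ := ∏ c ∈ lam.cells, lam.hook c

/-- A box can be added at the end of row `i`: increasing the `i`-th part by one gives a strict
partition again. The value `i = ℓ(λ)` stands for a new row with a single box. -/
def CanAdd (i : ℕ) : Prop := IsStrictSeq (lam.part + Finsupp.single i 1)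

/-- The last box of row `i` can be removed: decreasing the `i`-th part by one gives a strict
partition again. -/
def CanRemove (i : ℕ) : Prop :=
  0 < lam.part i ∧ IsStrictSeq (lam.part - Finsupp.single i 1)

/-- The strict partition obtained by adding a box at the end of row `i`. -/
noncomputable def addBox (i : ℕ) (h : lam.CanAdd i) : StrictPartition :=
  ⟨lam.part + Finsupp.single i 1, h⟩

open Classical in
/-- The outer corners: the boxes that can be removed. -/
noncomputable def outerCorners : Finset (ℕ × ℕ) :=
  ((Finset.range lam.length).filter lam.CanRemove).image fun i => (i, i + lam.part i)

open Classical in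
/-- The boxes that can be added to an already existing (nonempty) row. -/
noncomputable def addableBoxes : Finset (ℕ × ℕ) :=
  ((Finset.range lam.length).filter lam.CanAdd).image fun i => (i, i + lam.part i + 1)

/-- `Y(λ) = {y_1, …, y_m}`, the contents of the outer corners. -/
noncomputable def outerContents : Finset ℕ := lam.outerCorners.image boxContent

/-- `X(λ) = {x_0, x_1, …, x_m}`, the contents of the inner corners: `x_0 = 1` always belongs to it
(even if no box of content `1` can be added), and `x_1, …, x_m` are the contents of the boxes that
can be added to the existing rows. -/
noncomputable def innerContents : Finset ℕ := insert 1 (lam.addableBoxes.image boxContent)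

/-- `Φ^k(λ) = ∑ binom(x_i, 2)^k - ∑ binom(y_j, 2)^k`. -/
noncomputable def phiPow (k : ℕ) : ℚ :=
  ∑ x ∈ lam.innerContents, (x.choose 2 : ℚ) ^ k - ∑ y ∈ lam.outerContents, (y.choose 2 : ℚ) ^ k

/-- `Φ^ν(λ)`, the product of `Φ^{ν_j}(λ)` over the parts of the usual partition `ν`. -/
noncomputable def phi {n : ℕ} (nu : n.Partition) : ℚ := (nu.parts.map lam.phiPow).prod

/-- `p^k(λ)`, the sum of `h^(2k)` over the hook lengths `h` of the doubled distinct partition. -/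
def hookPow (k : ℕ) : ℚ := ∑ c ∈ lam.doubled.cells, ((lam.doubled.hook c : ℚ) ^ 2) ^ k

/-- `p^δ(λ)`, the product of `p^{δ_j}(λ)` over the parts of the usual partition `δ`. -/
def hookPowProd {n : ℕ} (delta : n.Partition) : ℚ := (delta.parts.map lam.hookPow).prod

open Classical in
/-- The difference operator on functions of strict partitions. The boxes of content
`x_1, …, x_m` are those added to the existing rows (coefficient `2`); the box of content `x_0 = 1`
is the one that forms a new row (coefficient `1`, and value `0` if it cannot be added). -/
noncomputable def diffOp (g : StrictPartition → ℚ) (lam : StrictPartition) : ℚ :=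
  2 * (∑ i ∈ Finset.range lam.length, if h : lam.CanAdd i then g (lam.addBox i h) else 0)
    + (if h : lam.CanAdd lam.length then g (lam.addBox lam.length h) else 0) - g lam

/-- The skew shifted diagram `λ/μ` (used when `μ ⊆ λ`). -/
def skewCells : Finset (ℕ × ℕ) := lam.cells \ mu.cells

/-- `f_{λ/μ}`, the number of standard shifted Young tableaux of shape `λ/μ`: bijective fillings of
the boxes by `0, …, n - 1` that increase along every row and every column. -/
noncomputable def numTableaux : ℕ :=
  Nat.card {T : lam.skewCells mu ≃ Fin (lam.skewCells mu).card //
    ∀ c d : lam.skewCells mu,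
      ((c.1.1 = d.1.1 ∧ c.1.2 < d.1.2) ∨ (c.1.2 = d.1.2 ∧ c.1.1 < d.1.1)) → T c < T d}

theorem finite_extensions (mu : StrictPartition) (n : ℕ) :
    {lam : StrictPartition | mu.part ≤ lam.part ∧ lam.size = mu.size + n}.Finite := by
  have hpart : ∀ lam : StrictPartition, ∀ i, lam.part i ≤ lam.size := fun lam i => by
    by_cases h : i ∈ lam.part.support
    · exact Finset.single_le_sum (f := fun i => lam.part i) (fun _ _ => Nat.zero_le _) h
    · rw [Finsupp.notMem_support_iff.mp h]
      exact Nat.zero_le _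
  have hinj : Function.Injective StrictPartition.part := fun a b h => StrictPartition.ext h
  refine Set.Finite.of_finite_image (f := StrictPartition.part) ?_ hinj.injOn
  refine (Finset.finite_toSet
    (Finset.finsuppAntidiag (Finset.range (mu.size + n)) (mu.size + n))).subset ?_
  rintro _ ⟨lam, ⟨-, hs⟩, rfl⟩
  have hsup : lam.part.support ⊆ Finset.range (mu.size + n) := fun i hi => by
    have hpos : 0 < lam.part i := Nat.pos_of_ne_zero (Finsupp.mem_support_iff.mp hi)
    have h1 := add_part_le (Nat.zero_le i) hpos
    have h2 := hpart lam 0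
    rw [Finset.mem_range]
    omega
  rw [Finset.mem_coe, Finset.mem_finsuppAntidiag]
  refine ⟨?_, hsup⟩
  refine Eq.trans (Finset.sum_subset hsup fun i _ hi => ?_).symm hs
  exact Finsupp.notMem_support_iff.mp hi

/-- The finite set of the strict partitions `λ ⊇ μ` with `|λ/μ| = n`. -/
noncomputable def extensions (mu : StrictPartition) (n : ℕ) : Finset StrictPartition :=
  (finite_extensions mu n).toFinset

/-- In the power `2 ^ (|λ| - ℓ(λ))` the subtraction is not truncated. -/
theorem length_le_size : lam.length ≤ lam.size := by
  rw [length, size, Finset.card_eq_sum_ones]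
  exact Finset.sum_le_sum fun i hi => Nat.one_le_iff_ne_zero.mpr (Finsupp.mem_support_iff.mp hi)

end StrictPartition

/-!
Let `λ_0 > λ_1 > ⋯ > λ_{ℓ-1}` be the parts of `λ`. The functions `Φ^ν` and `p^δ` are polynomials in
the odd power sums `∑ λ_i ^ (2k+1)`. Giving this sum the degree `k + 1` defines a filtered algebra
`degLE`, in which `Φ^ν` has degree at most `|ν|` and `p^δ` degree at most `|δ| + ℓ(δ)`.

* For `Φ^k` the corners telescope to the row ends, `Φ^k = ∑ C(λ_i + 1, 2)^k - C(λ_i, 2)^k`, and the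
  summand is an odd polynomial in `λ_i` (`phiPow_eq`, `phiPow_mem_degLE`).
* For `p^k` the hook lengths of the doubled diagram are the sums `λ_i + λ_j` and twice the multisets
  `{1, …, λ_i} \ {λ_i - λ_j : j > i}`, except that one copy of `λ_i` is missing
  (`sum_doubled_hook`). The even powers cancel in the resulting formula `hookPow_eq`.

The heart of the proof is that `D` maps `F / H`, with `F` of degree at most `d`, to `G / H` with
`G` of degree at most `d - 1`, and to `0` if `d = 0`. Adding a box to a row with part `λ_i` changes
`F` by a polynomial of total degree less than `d` in the node `z_i = C(λ_i + 1, 2)`, with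
coefficients in the filtered algebra (`exists_increment`), because `(x + 1)^(2k+1) - x^(2k+1)` is a
polynomial of degree `k` in `x (x + 1) / 2`. By the product formula for `H`, the ratios `2 H(λ) /
H(λ^{i+})` and `H(λ) / H(λ^{0+})` are the residues of `∏_{j<ℓ} (t - C(λ_j, 2)) / ∏_{j≤ℓ} (t -
z_j)`, where `z_ℓ = 0` is the node of the empty row; the residue vanishes if no box can be added
(`weight_of_canAdd`, `weight_of_not_canAdd`). Hence they sum to `1`, and Newton's identity
`succ_mul_moment_succ` expresses their `m`-th moment at the nodes through the `Φ^k`, so that it has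
degree at most `m` (`moment_mem_degLE`). Averaging the increment over the residues then gives `G`.

For the second assertion, removing the smallest entry of a tableau identifies the weighted sum over
tableaux with a constant times `(1 + D)^n (p^δ / H) = ∑ C(n, k) D^k (p^δ / H)`
(`sum_extensions_eq`), in which only the terms with `k ≤ |δ| + ℓ(δ)` survive.
-/

namespace StrictPartition

/-! ### Parts, and adding or removing a box -/

theorem part_lt_of_lt {lam : StrictPartition} {i j : ℕ} (hij : i < j) (hj : 0 < lam.part j) :
    lam.part j < lam.part i := by
  have := add_part_le hij.le hj
  omega

theorem part_eq_zero_of_le {lam : StrictPartition} {i j : ℕ} (hij : i ≤ j)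
    (hi : lam.part i = 0) : lam.part j = 0 := by
  by_contra h
  have := add_part_le hij (Nat.pos_of_ne_zero h)
  rcases hij.eq_or_lt with rfl | h'
  · exact h hi
  · have := part_lt_of_lt h' (Nat.pos_of_ne_zero h)
    omega

theorem support_part (lam : StrictPartition) :
    lam.part.support = Finset.range lam.length := by
  have hlow : ∀ j ∈ lam.part.support, Finset.range (j + 1) ⊆ lam.part.support := by
    intro j hj k hk
    rw [Finset.mem_range] at hk
    rw [Finsupp.mem_support_iff] at hj ⊢
    exact fun h => hj (part_eq_zero_of_le (by omega) h)
  refine Finset.eq_of_subset_of_card_le (fun j hj => ?_) (by simp [length])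
  have := Finset.card_le_card (hlow j hj)
  rw [Finset.card_range] at this
  rw [Finset.mem_range]
  exact this

theorem part_pos_iff {lam : StrictPartition} {i : ℕ} : 0 < lam.part i ↔ i < lam.length := by
  rw [← Finset.mem_range (m := i), ← support_part, Finsupp.mem_support_iff, Nat.pos_iff_ne_zero]

theorem part_eq_zero_iff {lam : StrictPartition} {i : ℕ} :
    lam.part i = 0 ↔ lam.length ≤ i := by
  have := part_pos_iff (lam := lam) (i := i)
  omega

theorem part_injOn (lam : StrictPartition) :
    Set.InjOn lam.part (Finset.range (lam.length + 1) : Finset ℕ) := by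
  intro i hi j hj h
  simp only [Finset.coe_range, Set.mem_Iio] at hi hj
  have key : ∀ a b, a < b → b < lam.length + 1 → lam.part a ≠ lam.part b := by
    intro a b hab hb h
    have ha : 0 < lam.part a := part_pos_iff.2 (by omega)
    have := part_lt_of_lt hab (h ▸ ha)
    omega
  rcases lt_trichotomy i j with h' | h' | h'
  · exact absurd h (key i j h' hj)
  · exact h'
  · exact absurd h.symm (key j i h' hi)

theorem canAdd_iff {lam : StrictPartition} {i : ℕ} :
    lam.CanAdd i ↔ ∀ j < i, lam.part i + 1 < lam.part j := by
  constructor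
  · intro h j hj
    have := part_lt_of_lt (lam := ⟨_, h⟩) hj (by simp)
    simpa [Finsupp.single_apply, hj.ne'] using this
  · intro h k
    have hk := lam.isStrict k
    simp only [Finsupp.add_apply, Finsupp.single_apply]
    rcases eq_or_ne i k with rfl | hik
    · simp only [if_true, if_neg (Nat.ne_of_lt (Nat.lt_succ_self i))]
      omega
    · rcases eq_or_ne i (k + 1) with rfl | hik'
      · have := h k (Nat.lt_succ_self k)
        simp only [if_true, if_neg hik]
        omega
      · simp only [if_neg hik, if_neg hik']
        omega

theorem CanAdd.le_length {lam : StrictPartition} {i : ℕ} (h : lam.CanAdd i) :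
    i ≤ lam.length := by
  by_contra! hlt
  have := canAdd_iff.1 h _ hlt
  rw [part_eq_zero_iff.2 le_rfl] at this
  omega

theorem canRemove_iff {lam : StrictPartition} {i : ℕ} :
    lam.CanRemove i ↔ 0 < lam.part i ∧
      (lam.part (i + 1) = 0 ∨ lam.part (i + 1) + 1 < lam.part i) := by
  refine and_congr_right fun hi => ?_
  have hi1 := lam.isStrict i
  constructor
  · intro h
    have := h i
    simp only [Finsupp.tsub_apply, Finsupp.single_apply, if_true,
      if_neg (Nat.ne_of_lt (Nat.lt_succ_self i))] at this
    omega
  · intro h k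
    have hk := lam.isStrict k
    simp only [Finsupp.tsub_apply, Finsupp.single_apply]
    rcases eq_or_ne i k with rfl | hik
    · simp only [if_true, if_neg (Nat.ne_of_lt (Nat.lt_succ_self i))]
      omega
    · rcases eq_or_ne i (k + 1) with rfl | hik'
      · simp only [if_true, if_neg hik]
        omega
      · simp only [if_neg hik, if_neg hik']
        omega

theorem addBox_part {lam : StrictPartition} {i : ℕ} (h : lam.CanAdd i) (j : ℕ) :
    (lam.addBox i h).part j = lam.part j + if i = j then 1 else 0 := by
  simp [addBox, Finsupp.single_apply]

theorem size_eq_sum (lam : StrictPartition) {L : ℕ} (hL : lam.length ≤ L) :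
    lam.size = ∑ i ∈ Finset.range L, lam.part i := by
  rw [size, support_part]
  refine Finset.sum_subset (Finset.range_mono hL) fun i _ hi => ?_
  exact part_eq_zero_iff.2 (by simpa using hi)

theorem length_addBox_of_lt {lam : StrictPartition} {i : ℕ} (h : lam.CanAdd i)
    (hi : i < lam.length) : (lam.addBox i h).length = lam.length := by
  refine le_antisymm ?_ ?_
  · rw [← part_eq_zero_iff, addBox_part, if_neg hi.ne, part_eq_zero_iff.2 le_rfl]
  · by_contra! hlt
    have h0 := part_eq_zero_iff.2 (le_refl (lam.addBox i h).length)
    rw [addBox_part] at h0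
    have := part_pos_iff.2 hlt
    omega

theorem length_addBox_length {lam : StrictPartition} (h : lam.CanAdd lam.length) :
    (lam.addBox lam.length h).length = lam.length + 1 := by
  refine le_antisymm ?_ ?_
  · rw [← part_eq_zero_iff, addBox_part, if_neg (by omega), part_eq_zero_iff.2 (by omega)]
  · rw [Nat.succ_le_iff, ← part_pos_iff, addBox_part, if_pos rfl]
    omega

theorem length_addBox_le {lam : StrictPartition} {i : ℕ} (h : lam.CanAdd i) :
    (lam.addBox i h).length ≤ lam.length + 1 := by
  rcases h.le_length.lt_or_eq with hi | rfl
  · rw [length_addBox_of_lt h hi]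
    omega
  · rw [length_addBox_length h]

theorem length_le_length_addBox {lam : StrictPartition} {i : ℕ} (h : lam.CanAdd i) :
    lam.length ≤ (lam.addBox i h).length := by
  rcases h.le_length.lt_or_eq with hi | rfl
  · rw [length_addBox_of_lt h hi]
  · rw [length_addBox_length h]
    omega

theorem size_addBox {lam : StrictPartition} {i : ℕ} (h : lam.CanAdd i) :
    (lam.addBox i h).size = lam.size + 1 := by
  rw [size_eq_sum _ (length_addBox_le h), size_eq_sum lam (Nat.le_succ _)]
  simp only [addBox_part, Finset.sum_add_distrib, Finset.sum_ite_eq, Finset.mem_range]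
  rw [if_pos (Nat.lt_succ_of_le h.le_length)]

/-- Every row of the shifted diagram reaches at least column `ℓ(λ)`. -/
theorem length_le_add_part {lam : StrictPartition} {i : ℕ} (hi : i < lam.length) :
    lam.length ≤ i + lam.part i := by
  have h1 := add_part_le (lam := lam) (i := i) (j := lam.length - 1) (by omega)
    (part_pos_iff.2 (by omega))
  have h2 : 0 < lam.part (lam.length - 1) := part_pos_iff.2 (by omega)
  omega

/-! ### Hook lengths of the shifted and the doubled diagram -/

open Finset

/-- The hook length, in the doubled diagram, of the box `(i, c)` in a row `i < ℓ(λ)` and a column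
`c ≥ ℓ(λ)`. Only rows numbered less than `ℓ(λ)` contribute to the leg. -/
def rowHook (lam : StrictPartition) (i c : ℕ) : ℕ :=
  (i + lam.part i - c) + #{k ∈ Ioo i lam.length | c ≤ k + lam.part k} + 1

/-- Row ends are weakly decreasing, so the rows below `i` that reach column `c` are
consecutive. -/
theorem filter_Ioo_le_eq (lam : StrictPartition) (i c : ℕ) :
    {k ∈ Ioo i lam.length | c ≤ k + lam.part k} =
      Ioo i (i + #{k ∈ Ioo i lam.length | c ≤ k + lam.part k} + 1) := by
  set A := {k ∈ Ioo i lam.length | c ≤ k + lam.part k} with hA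
  have hsub : ∀ j ∈ A, Ioo i (j + 1) ⊆ A := by
    intro j hj k hk
    simp only [hA, mem_filter, mem_Ioo] at hj hk ⊢
    have := add_part_le (show k ≤ j by omega) (part_pos_iff.2 hj.1.2)
    omega
  refine Finset.eq_of_subset_of_card_le (fun j hj => ?_) (by simp; omega)
  have h1 := Finset.card_le_card (hsub j hj)
  have h2 : i < j := (mem_Ioo.1 (mem_filter.1 hj).1).1
  rw [Nat.card_Ioo] at h1
  rw [mem_Ioo]
  omega

theorem le_add_part_iff {lam : StrictPartition} {i c j : ℕ} (hij : i < j)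
    (hj : j < lam.length) :
    c ≤ j + lam.part j ↔ j ≤ i + #{k ∈ Ioo i lam.length | c ≤ k + lam.part k} := by
  have h : j ∈ {k ∈ Ioo i lam.length | c ≤ k + lam.part k} ↔ _ :=
    Finset.ext_iff.1 (lam.filter_Ioo_le_eq i c) j
  simp only [mem_filter, mem_Ioo] at h
  omega

theorem rowHook_strictAntiOn (lam : StrictPartition) (i : ℕ) :
    StrictAntiOn (lam.rowHook i) (Icc lam.length (i + lam.part i) : Finset ℕ) := by
  intro c hc d hd hcd
  simp only [coe_Icc, Set.mem_Icc] at hc hd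
  have : #{k ∈ Ioo i lam.length | d ≤ k + lam.part k} ≤
      #{k ∈ Ioo i lam.length | c ≤ k + lam.part k} :=
    card_le_card (monotone_filter_right _ fun k _ hk => hcd.le.trans hk)
  simp only [rowHook]
  omega

/-- The hook length is greater than `λ_i - λ_j` if row `j` reaches column `c`, and smaller if
it does not. -/
theorem rowHook_ne (lam : StrictPartition) {i c j : ℕ}
    (hc : c ∈ Icc lam.length (i + lam.part i)) (hj : j ∈ Ioo i lam.length) :
    lam.rowHook i c ≠ lam.part i - lam.part j := by
  rw [mem_Icc] at hc
  rw [mem_Ioo] at hj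
  intro h
  have hlt := part_lt_of_lt hj.1 (part_pos_iff.2 hj.2)
  have hjpos : 0 < lam.part j := part_pos_iff.2 hj.2
  have hiff := le_add_part_iff (c := c) hj.1 hj.2
  simp only [rowHook] at h
  set N := #{k ∈ Ioo i lam.length | c ≤ k + lam.part k} with hN
  have : ¬ c ≤ j + lam.part j := by omega
  have hj' : i + N + 1 ≤ j := by omega
  omega

theorem rowHook_le (lam : StrictPartition) {i c : ℕ} (hi : i < lam.length)
    (hc : c ∈ Icc lam.length (i + lam.part i)) : lam.rowHook i c ≤ lam.part i := by
  rw [mem_Icc] at hc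
  have : #{k ∈ Ioo i lam.length | c ≤ k + lam.part k} ≤ lam.length - i - 1 := by
    refine (card_filter_le _ _).trans ?_
    simp
  simp only [rowHook]
  omega

/-- The hook lengths in the columns from `ℓ(λ)` on and the differences `λ_i - λ_j` are distinct
numbers in `{1, …, λ_i}`, and there are `λ_i` of them. -/
theorem image_rowHook_union (lam : StrictPartition) {i : ℕ} (hi : i < lam.length) :
    (Icc lam.length (i + lam.part i)).image (lam.rowHook i) ∪
      (Ioo i lam.length).image (fun j => lam.part i - lam.part j) = Icc 1 (lam.part i) ∧
    Disjoint ((Icc lam.length (i + lam.part i)).image (lam.rowHook i))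
      ((Ioo i lam.length).image (fun j => lam.part i - lam.part j)) ∧
    Set.InjOn (fun j => lam.part i - lam.part j) (Ioo i lam.length : Finset ℕ) := by
  have hlt : ∀ j ∈ Ioo i lam.length, 0 < lam.part j ∧ lam.part j < lam.part i := fun j hj => by
    rw [mem_Ioo] at hj
    exact ⟨part_pos_iff.2 hj.2, part_lt_of_lt hj.1 (part_pos_iff.2 hj.2)⟩
  have hdisj : Disjoint ((Icc lam.length (i + lam.part i)).image (lam.rowHook i))
      ((Ioo i lam.length).image (fun j => lam.part i - lam.part j)) := by
    rw [disjoint_left]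
    intro h h1 h2
    obtain ⟨c, hc, rfl⟩ := mem_image.1 h1
    obtain ⟨j, hj, h⟩ := mem_image.1 h2
    exact lam.rowHook_ne hc hj h.symm
  have hinj : Set.InjOn (fun j => lam.part i - lam.part j) (Ioo i lam.length : Finset ℕ) := by
    intro j hj k hk h
    have hj' := hlt j hj
    have hk' := hlt k hk
    rw [mem_coe, mem_Ioo] at hj hk
    refine lam.part_injOn (by simp; omega) (by simp; omega) ?_
    simp only at h
    omega
  refine ⟨Finset.eq_of_subset_of_card_le ?_ ?_, hdisj, hinj⟩
  · intro h hh
    rw [mem_Icc]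
    rcases mem_union.1 hh with hh | hh
    · obtain ⟨c, hc, rfl⟩ := mem_image.1 hh
      exact ⟨by simp [rowHook], lam.rowHook_le hi hc⟩
    · obtain ⟨j, hj, rfl⟩ := mem_image.1 hh
      have := hlt j hj
      omega
  · rw [card_union_of_disjoint hdisj, card_image_of_injOn hinj,
      card_image_of_injOn (lam.rowHook_strictAntiOn i).injOn]
    have := length_le_add_part hi
    simp only [Nat.card_Icc, Nat.card_Ioo]
    omega

/-- In each row the hook lengths in the columns from `ℓ(λ)` on, together with the differences of
the part with the smaller parts, are the numbers `1, …, λ_i`. -/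
@[to_additive /-- In each row the hook lengths in the columns from `ℓ(λ)` on, together with the
differences of the part with the smaller parts, are the numbers `1, …, λ_i`. -/]
theorem prod_rowHook_mul {M : Type*} [CommMonoid M] (lam : StrictPartition) {i : ℕ}
    (hi : i < lam.length) (φ : ℕ → M) :
    (∏ c ∈ Icc lam.length (i + lam.part i), φ (lam.rowHook i c)) *
      ∏ j ∈ Ioo i lam.length, φ (lam.part i - lam.part j) =
    ∏ h ∈ Icc 1 (lam.part i), φ h := by
  obtain ⟨h1, h2, h3⟩ := lam.image_rowHook_union hi
  rw [← h1, prod_union h2, prod_image h3, prod_image (lam.rowHook_strictAntiOn i).injOn]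

theorem diagramArm_cells (lam : StrictPartition) {i c : ℕ} (hic : i < c) :
    diagramArm lam.cells (i, c) = i + lam.part i - c := by
  have : {d ∈ lam.cells | d.1 = i ∧ c < d.2} = {i} ×ˢ Ioc c (i + lam.part i) := by
    ext ⟨k, d⟩
    simp only [mem_filter, mem_cells, mem_product, mem_singleton, mem_Ioc]
    constructor
    · rintro ⟨h1, rfl, h2⟩
      omega
    · rintro ⟨rfl, h2⟩
      omega
  rw [diagramArm, this]
  simp

/-- Hook lengths of the shifted diagram in the columns `c < ℓ(λ)`. -/
theorem hook_of_lt_length (lam : StrictPartition) {i c : ℕ} (hic : i < c) (hc : c < lam.length) :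
    lam.hook (i, c) = lam.part i + lam.part c := by
  have hleg : {d ∈ lam.cells | d.2 = c ∧ i < d.1} = Ioo i c ×ˢ {c} := by
    ext ⟨k, d⟩
    simp only [mem_filter, mem_cells, mem_product, mem_singleton, mem_Ioo]
    constructor
    · rintro ⟨h1, rfl, h2⟩
      omega
    · rintro ⟨h2, rfl⟩
      have := add_part_le (show k ≤ d by omega) (part_pos_iff.2 hc)
      omega
  have h1 := add_part_le hic.le (part_pos_iff.2 hc)
  have h2 := part_pos_iff.2 hc
  rw [hook, diagramArm_cells _ hic, diagramLeg, hleg]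
  simp only [card_product, Nat.card_Ioo, card_singleton]
  omega

/-- Hook lengths of the shifted diagram in the columns `c ≥ ℓ(λ)`. -/
theorem hook_of_length_le (lam : StrictPartition) {i c : ℕ} (hi : i < lam.length)
    (hc : lam.length ≤ c) : lam.hook (i, c) = lam.rowHook i c := by
  have hleg : {d ∈ lam.cells | d.2 = c ∧ i < d.1} =
      {k ∈ Ioo i lam.length | c ≤ k + lam.part k} ×ˢ {c} := by
    ext ⟨k, d⟩
    simp only [mem_filter, mem_cells, mem_product, mem_singleton, mem_Ioo, ← part_pos_iff]
    constructor
    · rintro ⟨h1, rfl, h2⟩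
      omega
    · rintro ⟨h2, rfl⟩
      have := part_pos_iff.1 h2.1.2
      omega
  rw [hook, diagramArm_cells _ (by omega), diagramLeg, hleg, part_eq_zero_iff.2 hc, rowHook]
  simp

/-- `H(λ) ∏_{i<j} (λ_i - λ_j) = ∏_i λ_i! ∏_{i<j} (λ_i + λ_j)`. -/
theorem hookProd_mul (lam : StrictPartition) :
    lam.hookProd * ∏ i ∈ range lam.length, ∏ j ∈ Ioo i lam.length, (lam.part i - lam.part j) =
      ∏ i ∈ range lam.length, ((lam.part i).factorial *
        ∏ j ∈ Ioo i lam.length, (lam.part i + lam.part j)) := by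
  rw [hookProd, prod_finset_product lam.cells (range lam.length)
    (fun i => Ioc i (i + lam.part i)), ← prod_mul_distrib]
  · refine prod_congr rfl fun i hi => ?_
    rw [mem_range] at hi
    have hL := length_le_add_part hi
    have hsplit : Ioc i (i + lam.part i) =
        Ioo i lam.length ∪ Icc lam.length (i + lam.part i) := by
      ext c
      simp only [mem_union, mem_Ioc, mem_Ioo, mem_Icc]
      omega
    have hdisj : Disjoint (Ioo i lam.length) (Icc lam.length (i + lam.part i)) := by
      rw [disjoint_left]
      intro c
      simp only [mem_Ioo, mem_Icc]
      omega
    have hfac : ∀ n : ℕ, n.factorial = ∏ h ∈ Icc 1 n, h := fun n => by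
      rw [← prod_range_add_one_eq_factorial, range_eq_Ico, prod_Ico_add' (fun h => h) 0 n 1]
      rfl
    rw [hsplit, prod_union hdisj, hfac, ← lam.prod_rowHook_mul hi (fun h => h),
      mul_comm (∏ c ∈ Ioo i lam.length, _), mul_right_comm]
    refine congrArg₂ _ (congrArg₂ _ ?_ rfl) ?_
    · exact prod_congr rfl fun c hc => lam.hook_of_length_le hi (mem_Icc.1 hc).1
    · exact prod_congr rfl fun c hc => lam.hook_of_lt_length (mem_Ioo.1 hc).1 (mem_Ioo.1 hc).2
  · rintro ⟨i, c⟩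
    simp only [mem_cells, mem_range, mem_Ioc, ← part_pos_iff]
    omega

theorem hookProd_pos (lam : StrictPartition) : 0 < lam.hookProd :=
  prod_pos fun c _ => by simp only [hook]; omega

theorem mem_doubled_of_row_lt {lam : StrictPartition} {i c : ℕ} (hi : i < lam.length) :
    (i, c) ∈ lam.doubled.cells ↔ c ≤ i + lam.part i := by
  simp only [doubled, mem_union, mem_cells, mem_doublingCells]
  have h1 := length_le_add_part hi
  rcases le_or_gt c i with h | h
  · have := length_le_add_part (lam := lam) (i := c) (by omega)
    omega
  · omega

theorem mem_doubled_of_column_lt {lam : StrictPartition} {i c : ℕ} (hc : c < lam.length) :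
    (i, c) ∈ lam.doubled.cells ↔ i < c + lam.part c := by
  simp only [doubled, mem_union, mem_cells, mem_doublingCells]
  have h1 := length_le_add_part hc
  rcases le_or_gt c i with h | h
  · omega
  · have := length_le_add_part (lam := lam) (i := i) (by omega)
    omega

theorem notMem_doubled {lam : StrictPartition} {i c : ℕ} (hi : lam.length ≤ i)
    (hc : lam.length ≤ c) : (i, c) ∉ lam.doubled.cells := by
  simp only [doubled, mem_union, mem_cells, mem_doublingCells]
  have h1 := part_eq_zero_iff.2 hi
  have h2 := part_eq_zero_iff.2 hc
  omega

theorem diagramArm_doubled (lam : StrictPartition) {i c : ℕ} (hi : i < lam.length) :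
    diagramArm lam.doubled.cells (i, c) = i + lam.part i - c := by
  have : {d ∈ lam.doubled.cells | d.1 = i ∧ c < d.2} = {i} ×ˢ Ioc c (i + lam.part i) := by
    ext ⟨k, d⟩
    simp only [mem_filter, mem_product, mem_singleton, mem_Ioc]
    constructor
    · rintro ⟨h1, rfl, h2⟩
      exact ⟨rfl, h2, (mem_doubled_of_row_lt hi).1 h1⟩
    · rintro ⟨rfl, h2⟩
      exact ⟨(mem_doubled_of_row_lt hi).2 h2.2, rfl, h2.1⟩
  rw [diagramArm, this]
  simp

theorem diagramLeg_doubled (lam : StrictPartition) {i c : ℕ} (hc : c < lam.length) :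
    diagramLeg lam.doubled.cells (i, c) = c + lam.part c - i - 1 := by
  have : {d ∈ lam.doubled.cells | d.2 = c ∧ i < d.1} = Ioo i (c + lam.part c) ×ˢ {c} := by
    ext ⟨k, d⟩
    simp only [mem_filter, mem_product, mem_singleton, mem_Ioo]
    constructor
    · rintro ⟨h1, rfl, h2⟩
      exact ⟨⟨h2, (mem_doubled_of_column_lt hc).1 h1⟩, rfl⟩
    · rintro ⟨h2, rfl⟩
      exact ⟨(mem_doubled_of_column_lt hc).2 h2.2, rfl, h2.1⟩
  rw [diagramLeg, this]
  simp

theorem doubled_hook_of_lt_of_lt (lam : StrictPartition) {i c : ℕ} (hi : i < lam.length)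
    (hc : c < lam.length) : lam.doubled.hook (i, c) = lam.part i + lam.part c := by
  have h1 := length_le_add_part hi
  have h2 := length_le_add_part hc
  rw [YoungDiagram.hook, diagramArm_doubled _ hi, diagramLeg_doubled _ hc]
  omega

theorem doubled_hook_of_row_lt (lam : StrictPartition) {i c : ℕ} (hi : i < lam.length)
    (hc : lam.length ≤ c) : lam.doubled.hook (i, c) = lam.rowHook i c := by
  have hleg : {d ∈ lam.doubled.cells | d.2 = c ∧ i < d.1} =
      {k ∈ Ioo i lam.length | c ≤ k + lam.part k} ×ˢ {c} := by
    ext ⟨k, d⟩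
    simp only [mem_filter, mem_product, mem_singleton, mem_Ioo]
    constructor
    · rintro ⟨h1, rfl, h2⟩
      have hk : k < lam.length := by
        by_contra! hk
        exact notMem_doubled hk hc h1
      exact ⟨⟨⟨h2, hk⟩, (mem_doubled_of_row_lt hk).1 h1⟩, rfl⟩
    · rintro ⟨h2, rfl⟩
      exact ⟨(mem_doubled_of_row_lt h2.1.2).2 h2.2, rfl, h2.1.1⟩
  rw [YoungDiagram.hook, diagramArm_doubled _ hi, diagramLeg, hleg, rowHook]
  simp

theorem doubled_hook_of_column_lt (lam : StrictPartition) {i c : ℕ} (hi : lam.length ≤ i)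
    (hc : c < lam.length) (hic : i < c + lam.part c) :
    lam.doubled.hook (i, c) = lam.rowHook c (i + 1) := by
  have harm : {d ∈ lam.doubled.cells | d.1 = i ∧ c < d.2} =
      {i} ×ˢ {k ∈ Ioo c lam.length | i + 1 ≤ k + lam.part k} := by
    ext ⟨k, d⟩
    simp only [mem_filter, mem_product, mem_singleton, mem_Ioo]
    constructor
    · rintro ⟨h1, rfl, h2⟩
      have hd : d < lam.length := by
        by_contra! hd
        exact notMem_doubled hi hd h1
      exact ⟨rfl, ⟨h2, hd⟩, (mem_doubled_of_column_lt hd).1 h1⟩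
    · rintro ⟨rfl, h2⟩
      exact ⟨(mem_doubled_of_column_lt h2.1.2).2 h2.2, rfl, h2.1.1⟩
  rw [YoungDiagram.hook, diagramLeg_doubled _ hc, diagramArm, harm, rowHook]
  simp only [card_product, card_singleton, one_mul]
  omega

theorem rowHook_length (lam : StrictPartition) {i : ℕ} (hi : i < lam.length) :
    lam.rowHook i lam.length = lam.part i := by
  have : {k ∈ Ioo i lam.length | lam.length ≤ k + lam.part k} = Ioo i lam.length :=
    filter_true_of_mem fun k hk => length_le_add_part (mem_Ioo.1 hk).2
  have h1 := length_le_add_part hi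
  rw [rowHook, this, Nat.card_Ioo]
  omega

/-- The hook lengths of the doubled diagram: all sums `λ_i + λ_j`, and, for each `i`, the multiset
`{1, …, λ_i} \ {λ_i - λ_j : j > i}` twice but for one copy of `λ_i`. -/
theorem sum_doubled_hook {M : Type*} [AddCommGroup M] (lam : StrictPartition) (φ : ℕ → M) :
    ∑ c ∈ lam.doubled.cells, φ (lam.doubled.hook c) =
      ∑ i ∈ range lam.length, ((∑ j ∈ range lam.length, φ (lam.part i + lam.part j)) +
        2 • ((∑ h ∈ Icc 1 (lam.part i), φ h) -
          ∑ j ∈ Ioo i lam.length, φ (lam.part i - lam.part j)) - φ (lam.part i)) := by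
  have hrow : ∑ c ∈ lam.doubled.cells with c.1 < lam.length, φ (lam.doubled.hook c) =
      ∑ i ∈ range lam.length, ((∑ j ∈ range lam.length, φ (lam.part i + lam.part j)) +
        ∑ c ∈ Icc lam.length (i + lam.part i), φ (lam.rowHook i c)) := by
    rw [sum_finset_product _ (range lam.length) (fun i => range (i + lam.part i + 1))]
    · refine sum_congr rfl fun i hi => ?_
      rw [mem_range] at hi
      have hL := length_le_add_part hi
      rw [← sum_range_add_sum_Ico _ (show lam.length ≤ i + lam.part i + 1 by omega)]
      refine congr_arg₂ _ (sum_congr rfl fun c hc => ?_) (sum_congr (by rfl) fun c hc => ?_)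
      · rw [lam.doubled_hook_of_lt_of_lt hi (mem_range.1 hc)]
      · rw [lam.doubled_hook_of_row_lt hi (mem_Icc.1 hc).1]
    · rintro ⟨i, c⟩
      simp only [mem_filter, mem_range, Nat.lt_succ_iff]
      rw [and_comm]
      exact and_congr_right fun hi => mem_doubled_of_row_lt hi
  have hcol : ∑ c ∈ lam.doubled.cells with ¬ c.1 < lam.length, φ (lam.doubled.hook c) =
      ∑ i ∈ range lam.length,
        ((∑ c ∈ Icc lam.length (i + lam.part i), φ (lam.rowHook i c)) - φ (lam.part i)) := by
    rw [sum_finset_product_right _ (range lam.length) (fun i => Ico lam.length (i + lam.part i))]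
    · refine sum_congr rfl fun i hi => ?_
      rw [mem_range] at hi
      have hL := length_le_add_part hi
      -- The box in row `r` of column `i` has the hook length of column `r + 1` in row `i`, so the
      -- value at column `ℓ(λ)`, which is `λ_i`, is the one that is left out.
      rw [← Ioc_insert_left hL, sum_insert (by simp), lam.rowHook_length hi,
        add_sub_cancel_left]
      refine sum_bij (fun r _ => r + 1) ?_ ?_ ?_ ?_
      · intro r hr
        simp only [mem_Ico, mem_Ioc] at hr ⊢
        omega
      · intro r _ s _ h
        omega
      · intro r hr
        simp only [mem_Ioc] at hr
        exact ⟨r - 1, by simp only [mem_Ico]; omega, by omega⟩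
      · intro r hr
        rw [mem_Ico] at hr
        rw [lam.doubled_hook_of_column_lt hr.1 hi hr.2]
    · rintro ⟨i, c⟩
      simp only [mem_filter, mem_range, mem_Ico, not_lt]
      constructor
      · rintro ⟨h1, h2⟩
        have hc : c < lam.length := by
          by_contra! hc
          exact notMem_doubled h2 hc h1
        exact ⟨hc, h2, (mem_doubled_of_column_lt hc).1 h1⟩
      · rintro ⟨hc, h2, h1⟩
        exact ⟨(mem_doubled_of_column_lt hc).2 h1, h2⟩
  rw [← sum_filter_add_sum_filter_not _ (fun c : ℕ × ℕ => c.1 < lam.length), hrow, hcol,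
    ← sum_add_distrib]
  refine sum_congr rfl fun i hi => ?_
  rw [← lam.sum_rowHook_add (mem_range.1 hi) φ]
  abel

/-! ### The filtered algebra of odd power sums -/

/-- The span of the odd powers `x, x³, …, x^(2k-1)`, as functions on the natural numbers. -/
def oddPowSpan (k : ℕ) : Submodule ℚ (ℕ → ℚ) :=
  Submodule.span ℚ {q | ∃ j < k, q = fun x : ℕ => (x : ℚ) ^ (2 * j + 1)}

theorem pow_mem_oddPowSpan {j k : ℕ} (h : j < k) :
    (fun x : ℕ => (x : ℚ) ^ (2 * j + 1)) ∈ oddPowSpan k :=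
  Submodule.subset_span ⟨j, h, rfl⟩

theorem choose_pow_sub_mem_oddPowSpan (k : ℕ) :
    (fun x : ℕ => (((x + 1).choose 2 : ℕ) : ℚ) ^ k - ((x.choose 2 : ℕ) : ℚ) ^ k) ∈
      oddPowSpan k := by
  have h : (fun x : ℕ => (((x + 1).choose 2 : ℕ) : ℚ) ^ k - ((x.choose 2 : ℕ) : ℚ) ^ k) =
      ∑ m ∈ range (k + 1), fun x : ℕ =>
        ((1 - (-1) ^ (m + k)) * (k.choose m : ℚ) / 2 ^ k) * (x : ℚ) ^ (m + k) := by
    ext x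
    rw [Nat.cast_choose_two, Nat.cast_choose_two, Finset.sum_apply]
    push_cast
    have h1 := add_pow (x : ℚ) 1 k
    have h2 := sub_pow (x : ℚ) 1 k
    rw [show ((x : ℚ) + 1) * (x + 1 - 1) / 2 = (x + 1) * (x / 2) by ring,
      show (x : ℚ) * (x - 1) / 2 = (x - 1) * (x / 2) by ring, mul_pow, mul_pow, h1, h2,
      Finset.sum_mul, Finset.sum_mul, ← Finset.sum_sub_distrib]
    refine sum_congr rfl fun m _ => ?_
    rw [div_pow, pow_add (x : ℚ)]
    simp only [one_pow]
    ring
  rw [h]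
  refine Submodule.sum_mem _ fun m hm => ?_
  rw [mem_range] at hm
  rcases Nat.even_or_odd (m + k) with he | ho
  · simp only [he.neg_one_pow, sub_self, zero_mul, zero_div]
    exact Submodule.zero_mem _
  · obtain ⟨j, hj⟩ := ho
    rw [hj]
    exact Submodule.smul_mem _ _ (pow_mem_oddPowSpan (by omega))

/-- Faulhaber's formula, in which the odd Bernoulli numbers other than `B₁` vanish. -/
theorem two_mul_sum_pow_sub_mem_oddPowSpan {k : ℕ} (hk : k ≠ 0) :
    (fun x : ℕ => 2 * (∑ h ∈ Icc 1 x, (h : ℚ) ^ (2 * k)) - (x : ℚ) ^ (2 * k)) ∈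
      oddPowSpan (k + 1) := by
  have h : (fun x : ℕ => 2 * (∑ h ∈ Icc 1 x, (h : ℚ) ^ (2 * k)) - (x : ℚ) ^ (2 * k)) =
      ∑ i ∈ range (2 * k + 1), fun x : ℕ =>
        (2 * (bernoulli i * ((2 * k + 1).choose i : ℚ) / (2 * k + 1 : ℕ)) +
          if i = 1 then 1 else 0) * (x : ℚ) ^ (2 * k + 1 - i) := by
    ext x
    have h0 : ∑ h ∈ Icc 1 x, (h : ℚ) ^ (2 * k) =
        ∑ h ∈ range x, (h : ℚ) ^ (2 * k) + (x : ℚ) ^ (2 * k) := by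
      rw [← sum_range_succ, range_eq_Ico, Finset.sum_eq_sum_Ico_succ_bot (Nat.succ_pos x)]
      rw [Nat.cast_zero, zero_pow (by omega), zero_add]
      rfl
    have h1 : ∑ i ∈ range (2 * k + 1),
        (if i = 1 then (1 : ℚ) else 0) * (x : ℚ) ^ (2 * k + 1 - i) = (x : ℚ) ^ (2 * k) := by
      simp only [ite_mul, one_mul, zero_mul, sum_ite_eq', mem_range]
      rw [if_pos (by omega)]
      rfl
    simp only [Finset.sum_apply, add_mul, sum_add_distrib]
    rw [h1, h0, sum_range_pow, mul_add, mul_sum]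
    have : ∀ i ∈ range (2 * k + 1), 2 * (bernoulli i * ((2 * k + 1).choose i : ℚ) *
        (x : ℚ) ^ (2 * k + 1 - i) / ((2 * k : ℕ) + 1)) =
        2 * (bernoulli i * ((2 * k + 1).choose i : ℚ) / (2 * k + 1 : ℕ)) *
        (x : ℚ) ^ (2 * k + 1 - i) := fun i _ => by
      push_cast
      ring
    rw [sum_congr rfl this]
    ring
  rw [h]
  refine Submodule.sum_mem _ fun i hi => ?_
  rw [mem_range] at hi
  rcases Nat.even_or_odd' i with ⟨m, rfl | rfl⟩
  · rw [show 2 * k + 1 - 2 * m = 2 * (k - m) + 1 by omega]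
    exact Submodule.smul_mem _ _ (pow_mem_oddPowSpan (by omega))
  · rcases Nat.eq_zero_or_pos m with rfl | hm
    -- The term of `B₁ = -1/2` cancels against the subtracted `x^(2k)`.
    · have h2 : (2 : ℚ) * (k : ℚ) + 1 ≠ 0 := by positivity
      convert Submodule.zero_mem _ using 1
      ext x
      norm_num [bernoulli_one]
      left
      field_simp
      ring
    · rw [bernoulli_eq_zero_of_odd ⟨m, rfl⟩ (by omega), if_neg (by omega)]
      simp only [zero_mul, zero_div, mul_zero, add_zero]
      exact Submodule.zero_mem _

/-- The odd power sum `∑ λ_i ^ (2k+1)`. -/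
def oddSum (k : ℕ) (lam : StrictPartition) : ℚ :=
  ∑ i ∈ range lam.length, (lam.part i : ℚ) ^ (2 * k + 1)

theorem oddSum_eq (k : ℕ) (lam : StrictPartition) {L : ℕ} (hL : lam.length ≤ L) :
    oddSum k lam = ∑ i ∈ range L, (lam.part i : ℚ) ^ (2 * k + 1) := by
  refine Finset.sum_subset (range_mono hL) fun i _ hi => ?_
  rw [part_eq_zero_iff.2 (by simpa using hi), Nat.cast_zero, zero_pow (by omega)]

/-- The functions of degree at most `d`: polynomials in the odd power sums, where
`∑ λ_i ^ (2k+1)` is given degree `k + 1`. -/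
def degLE (d : ℕ) : Submodule ℚ (StrictPartition → ℚ) :=
  Submodule.span ℚ {f | ∃ s : Multiset ℕ, (s.map (· + 1)).sum ≤ d ∧ f = (s.map oddSum).prod}

theorem degLE_mono {d e : ℕ} (h : d ≤ e) : degLE d ≤ degLE e :=
  Submodule.span_mono fun _ ⟨s, hs, hf⟩ => ⟨s, hs.trans h, hf⟩

theorem one_mem_degLE (d : ℕ) : (1 : StrictPartition → ℚ) ∈ degLE d :=
  Submodule.subset_span ⟨0, by simp, by simp⟩

theorem oddSum_mem_degLE (k : ℕ) : oddSum k ∈ degLE (k + 1) :=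
  Submodule.subset_span ⟨{k}, by simp, by simp⟩

theorem mul_mem_degLE {d e : ℕ} {f g : StrictPartition → ℚ} (hf : f ∈ degLE d)
    (hg : g ∈ degLE e) : f * g ∈ degLE (d + e) := by
  have h : f * g ∈ degLE d * degLE e := Submodule.mul_mem_mul hf hg
  rw [degLE, degLE, Submodule.span_mul_span] at h
  refine Submodule.span_mono ?_ h
  rintro _ ⟨_, ⟨s, hs, rfl⟩, _, ⟨t, ht, rfl⟩, rfl⟩
  exact ⟨s + t, by simpa using add_le_add hs ht, by simp⟩

theorem multiset_prod_mem_degLE {F : ℕ → StrictPartition → ℚ} {c : ℕ} (s : Multiset ℕ)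
    (h : ∀ k ∈ s, F k ∈ degLE (k + c)) :
    (s.map F).prod ∈ degLE (s.sum + c * s.card) := by
  induction s using Multiset.induction_on with
  | empty => simpa using one_mem_degLE 0
  | cons k s ih =>
    rw [Multiset.map_cons, Multiset.prod_cons, Multiset.sum_cons, Multiset.card_cons]
    refine degLE_mono (le_of_eq ?_) (mul_mem_degLE (h k (Multiset.mem_cons_self k s))
      (ih fun j hj => h j (Multiset.mem_cons_of_mem hj)))
    ring

theorem sum_mem_degLE_of_mem_oddPowSpan {k : ℕ} {q : ℕ → ℚ} (hq : q ∈ oddPowSpan k) :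
    (fun lam : StrictPartition => ∑ i ∈ range lam.length, q (lam.part i)) ∈ degLE k := by
  induction hq using Submodule.span_induction with
  | mem q hq =>
    obtain ⟨j, hj, rfl⟩ := hq
    exact degLE_mono hj (oddSum_mem_degLE j)
  | zero =>
    simp only [Pi.zero_apply, sum_const_zero]
    exact Submodule.zero_mem _
  | add p q _ _ hp hq => simpa [sum_add_distrib] using! Submodule.add_mem _ hp hq
  | smul c q _ hq =>
    simp only [Pi.smul_apply, smul_eq_mul, ← mul_sum]
    exact Submodule.smul_mem _ c hq

/-- The set of the (positive) parts. -/
def partSet (lam : StrictPartition) : Finset ℕ := (range lam.length).image lam.part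

theorem mem_partSet {lam : StrictPartition} {x : ℕ} :
    x ∈ lam.partSet ↔ ∃ i < lam.length, lam.part i = x := by
  simp [partSet]

theorem innerContents_eq (lam : StrictPartition) :
    lam.innerContents = insert 1 (lam.partSet.image (· + 1) \ lam.partSet) := by
  rw [innerContents, addableBoxes, image_image]
  congr 1
  ext x
  simp only [mem_image, mem_filter, mem_range, Function.comp_apply, boxContent, mem_sdiff,
    mem_partSet]
  constructor
  · rintro ⟨i, ⟨hi, hadd⟩, rfl⟩
    rw [canAdd_iff] at hadd
    refine ⟨⟨lam.part i, ⟨i, hi, rfl⟩, by omega⟩, ?_⟩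
    rintro ⟨j, hj, h⟩
    rcases lt_or_ge j i with h' | h'
    · have := hadd j h'
      omega
    · rcases h'.eq_or_lt with rfl | h'
      · omega
      · have := part_lt_of_lt h' (part_pos_iff.2 hj)
        omega
  · rintro ⟨⟨_, ⟨i, hi, rfl⟩, rfl⟩, h⟩
    refine ⟨i, ⟨hi, canAdd_iff.2 fun j hj => ?_⟩, by omega⟩
    have h1 := part_lt_of_lt hj (part_pos_iff.2 hi)
    have h2 : lam.part j ≠ lam.part i + 1 := fun h2 => h ⟨j, by omega, h2⟩
    omega

theorem outerContents_eq (lam : StrictPartition) :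
    lam.outerContents = lam.partSet \ lam.partSet.image (· + 1) := by
  rw [outerContents, outerCorners, image_image]
  ext x
  simp only [mem_image, mem_filter, mem_range, Function.comp_apply, boxContent, mem_sdiff,
    mem_partSet]
  constructor
  · rintro ⟨i, ⟨hi, hrem⟩, rfl⟩
    rw [canRemove_iff] at hrem
    refine ⟨⟨i, hi, by omega⟩, ?_⟩
    rintro ⟨_, ⟨j, hj, rfl⟩, h⟩
    have hjpos := part_pos_iff.2 hj
    rcases lt_or_ge i j with h' | h'
    · have h1 := add_part_le (show i + 1 ≤ j by omega) hjpos
      omega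
    · have := add_part_le h' (part_pos_iff.2 hi)
      omega
  · rintro ⟨⟨i, hi, rfl⟩, h⟩
    refine ⟨i, ⟨hi, canRemove_iff.2 ⟨part_pos_iff.2 hi, ?_⟩⟩, by omega⟩
    rcases Nat.eq_zero_or_pos (lam.part (i + 1)) with h0 | h0
    · exact Or.inl h0
    · have h1 := part_lt_of_lt (i := i) (j := i + 1) (by omega) h0
      have h2 : lam.part (i + 1) + 1 ≠ lam.part i :=
        fun h2 => h ⟨_, ⟨i + 1, part_pos_iff.1 h0, rfl⟩, h2⟩
      omega

/-- In `Φ^k` the corners may be replaced by the row ends: `∑ C(λ_i + 1, 2)^k - C(λ_i, 2)^k`, where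
two consecutive parts produce terms that cancel. -/
theorem phiPow_eq (lam : StrictPartition) {k : ℕ} (hk : k ≠ 0) :
    lam.phiPow k = ∑ i ∈ range lam.length,
      ((((lam.part i + 1).choose 2 : ℕ) : ℚ) ^ k - (((lam.part i).choose 2 : ℕ) : ℚ) ^ k) := by
  have hinj : Set.InjOn lam.part (range lam.length : Finset ℕ) :=
    lam.part_injOn.mono (by simp)
  rw [phiPow, innerContents_eq, outerContents_eq, sum_insert, Nat.choose_eq_zero_of_lt (by omega),
    Nat.cast_zero, zero_pow hk, zero_add, sum_sdiff_sub_sum_sdiff,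
    sum_image (fun _ _ _ _ h => Nat.succ_injective h), partSet, sum_image hinj, sum_image hinj,
    sum_sub_distrib]
  simp only [mem_sdiff, mem_image, mem_partSet]
  rintro ⟨⟨_, ⟨i, hi, rfl⟩, h⟩, -⟩
  have := part_pos_iff.2 hi
  omega

theorem phiPow_mem_degLE {k : ℕ} (hk : k ≠ 0) :
    (fun lam : StrictPartition => lam.phiPow k) ∈ degLE k := by
  simp only [phiPow_eq _ hk]
  exact sum_mem_degLE_of_mem_oddPowSpan (choose_pow_sub_mem_oddPowSpan k)

theorem sum_range_sum_range_eq_two_mul {L : ℕ} {f : ℕ → ℕ → ℚ} (hsymm : ∀ i j, f i j = f j i)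
    (hdiag : ∀ i, f i i = 0) :
    ∑ i ∈ range L, ∑ j ∈ range L, f i j = 2 * ∑ i ∈ range L, ∑ j ∈ Ioo i L, f i j := by
  have h1 : ∑ i ∈ range L, ∑ j ∈ range i, f i j = ∑ i ∈ range L, ∑ j ∈ Ioo i L, f i j := by
    rw [sum_comm' (t' := range L) (s' := fun j => Ioo j L)]
    · exact sum_congr rfl fun i _ => sum_congr rfl fun j _ => hsymm j i
    · intro i j
      simp only [mem_range, mem_Ioo]
      omega
  rw [two_mul]
  nth_rewrite 1 [← h1]
  rw [← sum_add_distrib]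
  refine sum_congr rfl fun i hi => ?_
  rw [mem_range] at hi
  rw [← sum_range_add_sum_Ico _ hi.le, Finset.sum_eq_sum_Ico_succ_bot hi, hdiag, zero_add]
  rfl

/-- The differences among the hook lengths cancel the even part of the sums: the double sum
`∑ (λ_i + λ_j)^(2k) - (λ_i - λ_j)^(2k)` is odd in each variable. -/
theorem hookPow_eq (lam : StrictPartition) {k : ℕ} (hk : k ≠ 0) :
    lam.hookPow k = (∑ i ∈ range lam.length, ∑ j ∈ range lam.length,
        (((lam.part i : ℚ) + lam.part j) ^ (2 * k) - ((lam.part i : ℚ) - lam.part j) ^ (2 * k))) +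
      ∑ i ∈ range lam.length,
        (2 * (∑ h ∈ Icc 1 (lam.part i), (h : ℚ) ^ (2 * k)) - (lam.part i : ℚ) ^ (2 * k)) := by
  have h1 : lam.hookPow k =
      ∑ c ∈ lam.doubled.cells, (lam.doubled.hook c : ℚ) ^ (2 * k) := by
    simp only [hookPow, pow_mul]
  have h2 := sum_range_sum_range_eq_two_mul (L := lam.length)
    (f := fun i j => ((lam.part i : ℚ) - lam.part j) ^ (2 * k))
    (fun i j => by rw [pow_mul, pow_mul, sub_sq_comm]) (fun i => by simp [hk])
  have h3 : ∑ i ∈ range lam.length, ∑ j ∈ Ioo i lam.length,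
      ((lam.part i - lam.part j : ℕ) : ℚ) ^ (2 * k) =
      ∑ i ∈ range lam.length, ∑ j ∈ Ioo i lam.length,
        ((lam.part i : ℚ) - lam.part j) ^ (2 * k) := by
    refine sum_congr rfl fun i _ => sum_congr rfl fun j hj => ?_
    rw [mem_Ioo] at hj
    rw [Nat.cast_sub (part_lt_of_lt hj.1 (part_pos_iff.2 hj.2)).le]
  rw [h1, lam.sum_doubled_hook (fun h => (h : ℚ) ^ (2 * k))]
  simp only [sum_sub_distrib, sum_add_distrib, nsmul_eq_mul, ← mul_sum, Nat.cast_add]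
  rw [h2, h3]
  push_cast
  ring

theorem sum_pow_sub_mem_degLE (k : ℕ) :
    (fun lam : StrictPartition => ∑ i ∈ range lam.length, ∑ j ∈ range lam.length,
      (((lam.part i : ℚ) + lam.part j) ^ (2 * k) - ((lam.part i : ℚ) - lam.part j) ^ (2 * k))) ∈
      degLE (k + 1) := by
  have h : (fun lam : StrictPartition => ∑ i ∈ range lam.length, ∑ j ∈ range lam.length,
      (((lam.part i : ℚ) + lam.part j) ^ (2 * k) - ((lam.part i : ℚ) - lam.part j) ^ (2 * k))) =
      ∑ m ∈ range (2 * k + 1), fun lam : StrictPartition =>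
        ((1 - (-1) ^ m) * ((2 * k).choose m : ℚ)) *
        ((∑ i ∈ range lam.length, (lam.part i : ℚ) ^ m) *
          ∑ j ∈ range lam.length, (lam.part j : ℚ) ^ (2 * k - m)) := by
    ext lam
    rw [Finset.sum_apply]
    simp_rw [sum_mul_sum, mul_sum]
    rw [sum_comm (s := range (2 * k + 1))]
    refine sum_congr rfl fun i _ => ?_
    rw [sum_comm (s := range (2 * k + 1))]
    refine sum_congr rfl fun j _ => ?_
    rw [add_pow, sub_pow, ← sum_sub_distrib]
    refine sum_congr rfl fun m _ => ?_
    rw [pow_add (-1 : ℚ), (even_two_mul k).neg_one_pow]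
    ring
  rw [h]
  refine Submodule.sum_mem _ fun m hm => ?_
  rw [mem_range] at hm
  rcases Nat.even_or_odd m with he | ho
  · simp only [he.neg_one_pow, sub_self, zero_mul]
    exact Submodule.zero_mem _
  · obtain ⟨j, rfl⟩ := ho
    rw [show 2 * k - (2 * j + 1) = 2 * (k - j - 1) + 1 by omega]
    exact Submodule.smul_mem _ _ (degLE_mono (by omega)
      (mul_mem_degLE (oddSum_mem_degLE j) (oddSum_mem_degLE (k - j - 1))))

theorem hookPow_mem_degLE {k : ℕ} (hk : k ≠ 0) :
    (fun lam : StrictPartition => lam.hookPow k) ∈ degLE (k + 1) := by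
  simp only [hookPow_eq _ hk]
  exact Submodule.add_mem _ (sum_pow_sub_mem_degLE k)
    (sum_mem_degLE_of_mem_oddPowSpan (two_mul_sum_pow_sub_mem_oddPowSpan hk))

theorem phi_mem_degLE {a : ℕ} (nu : a.Partition) :
    (fun lam : StrictPartition => lam.phi nu) ∈ degLE a := by
  have h := multiset_prod_mem_degLE (F := fun k (lam : StrictPartition) => lam.phiPow k) (c := 0)
    nu.parts (fun k hk => phiPow_mem_degLE (nu.parts_pos hk).ne')
  rw [nu.parts_sum, zero_mul, add_zero] at h
  convert h using 1
  ext lam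
  rw [phi]
  refine Eq.trans ?_ (map_multiset_prod (Pi.evalRingHom (fun _ : StrictPartition => ℚ) lam) _).symm
  rw [Multiset.map_map]
  rfl

theorem hookPowProd_mem_degLE {b : ℕ} (delta : b.Partition) :
    (fun lam : StrictPartition => lam.hookPowProd delta) ∈ degLE (b + delta.parts.card) := by
  have h := multiset_prod_mem_degLE (F := fun k (lam : StrictPartition) => lam.hookPow k) (c := 1)
    delta.parts (fun k hk => hookPow_mem_degLE (delta.parts_pos hk).ne')
  rw [delta.parts_sum, one_mul] at h
  convert h using 1
  ext lam
  rw [hookPowProd]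
  refine Eq.trans ?_ (map_multiset_prod (Pi.evalRingHom (fun _ : StrictPartition => ℚ) lam) _).symm
  rw [Multiset.map_map]
  rfl

/-! ### The transition weights as residues -/

/-- `C(λ_i + 1, 2)`, a node of the interpolation; for `i = ℓ(λ)` it is `0`. -/
def node (lam : StrictPartition) (i : ℕ) : ℚ := ((lam.part i + 1).choose 2 : ℕ)

/-- `C(λ_i, 2)`. -/
def conode (lam : StrictPartition) (i : ℕ) : ℚ := ((lam.part i).choose 2 : ℕ)

theorem node_eq (lam : StrictPartition) (i : ℕ) :
    lam.node i = (lam.part i : ℚ) * (lam.part i + 1) / 2 := by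
  rw [node, Nat.cast_choose_two]
  push_cast
  ring

theorem conode_eq (lam : StrictPartition) (i : ℕ) :
    lam.conode i = (lam.part i : ℚ) * (lam.part i - 1) / 2 :=
  Nat.cast_choose_two ℚ _

theorem node_of_length_le {lam : StrictPartition} {i : ℕ} (h : lam.length ≤ i) :
    lam.node i = 0 := by
  rw [node_eq, part_eq_zero_iff.2 h]
  simp

theorem node_injOn (lam : StrictPartition) :
    Set.InjOn lam.node (range (lam.length + 1) : Finset ℕ) := by
  intro i hi j hj h
  refine lam.part_injOn hi hj ?_
  rw [node_eq, node_eq] at h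
  have h1 : ((lam.part i : ℚ) - lam.part j) * (lam.part i + lam.part j + 1) = 0 := by
    linear_combination 2 * h
  have h2 : (lam.part i : ℚ) + lam.part j + 1 ≠ 0 := by positivity
  have h3 := (mul_eq_zero.1 h1).resolve_right h2
  exact_mod_cast sub_eq_zero.1 h3

/-- The residue of `∏_{j<ℓ} (t - C(λ_j, 2)) / ∏_{j≤ℓ} (t - C(λ_j + 1, 2))` at
`t = C(λ_i + 1, 2)`. -/
def weight (lam : StrictPartition) (i : ℕ) : ℚ :=
  (∏ j ∈ range lam.length, (lam.node i - lam.conode j)) /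
    ∏ j ∈ (range (lam.length + 1)).erase i, (lam.node i - lam.node j)

/-- The rational form of the hook product. It may include one part equal to zero, which
contributes the factors `(λ_i + 0) / (λ_i - 0) = 1`. -/
theorem hookProd_eq (lam : StrictPartition) {L : ℕ} (h1 : lam.length ≤ L)
    (h2 : L ≤ lam.length + 1) :
    (lam.hookProd : ℚ) = (∏ i ∈ range L, ((lam.part i).factorial : ℚ)) *
      ∏ i ∈ range L, ∏ j ∈ Ioo i L,
        ((lam.part i : ℚ) + lam.part j) / (lam.part i - lam.part j) := by
  have key : (lam.hookProd : ℚ) = (∏ i ∈ range lam.length, ((lam.part i).factorial : ℚ)) *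
      ∏ i ∈ range lam.length, ∏ j ∈ Ioo i lam.length,
        ((lam.part i : ℚ) + lam.part j) / (lam.part i - lam.part j) := by
    have h := congrArg (Nat.cast (R := ℚ)) lam.hookProd_mul
    have hcast : ((∏ i ∈ range lam.length, ∏ j ∈ Ioo i lam.length,
        (lam.part i - lam.part j) : ℕ) : ℚ) = ∏ i ∈ range lam.length, ∏ j ∈ Ioo i lam.length,
          ((lam.part i : ℚ) - lam.part j) := by
      rw [Nat.cast_prod]
      refine prod_congr rfl fun i _ => ?_
      rw [Nat.cast_prod]
      refine prod_congr rfl fun j hj => ?_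
      rw [mem_Ioo] at hj
      rw [Nat.cast_sub (part_lt_of_lt hj.1 (part_pos_iff.2 hj.2)).le]
    have hne : ∏ i ∈ range lam.length, ∏ j ∈ Ioo i lam.length,
        ((lam.part i : ℚ) - lam.part j) ≠ 0 := by
      refine prod_ne_zero_iff.2 fun i _ => prod_ne_zero_iff.2 fun j hj => ?_
      rw [mem_Ioo] at hj
      have : (lam.part j : ℚ) < lam.part i := by
        exact_mod_cast part_lt_of_lt hj.1 (part_pos_iff.2 hj.2)
      exact (sub_pos.2 this).ne'
    rw [Nat.cast_mul, hcast] at h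
    simp only [prod_div_distrib]
    rw [← mul_div_assoc, eq_div_iff hne, h]
    push_cast
    rw [prod_mul_distrib]
  rcases (show L = lam.length ∨ L = lam.length + 1 by omega) with rfl | rfl
  · exact key
  · rw [key, prod_range_succ, part_eq_zero_iff.2 le_rfl, Nat.factorial_zero, Nat.cast_one,
      mul_one, prod_range_succ]
    have hempty : Ioo lam.length (lam.length + 1) = ∅ := by
      ext j
      simp only [mem_Ioo, notMem_empty, iff_false]
      omega
    rw [hempty, prod_empty, mul_one]
    refine congrArg₂ _ rfl (prod_congr rfl fun i hi => ?_)
    rw [mem_range] at hi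
    have hsplit : Ioo i (lam.length + 1) = insert lam.length (Ioo i lam.length) := by
      ext j
      simp only [mem_Ioo, mem_insert]
      omega
    have hpos : (lam.part i : ℚ) ≠ 0 := by exact_mod_cast (part_pos_iff.2 hi).ne'
    rw [hsplit, prod_insert (by simp), part_eq_zero_iff.2 le_rfl, Nat.cast_zero, add_zero,
      sub_zero, div_self hpos, one_mul]

/-- How a product over pairs changes when the factors of the pairs containing `r` change. -/
theorem prod_Ioo_mul_prod_erase {L r : ℕ} (hr : r < L) {g g' : ℕ → ℕ → ℚ} {ρ : ℕ → ℚ}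
    (h1 : ∀ j, r < j → j < L → g' r j = g r j * ρ j)
    (h2 : ∀ i < r, g' i r = g i r * ρ i)
    (h3 : ∀ i j, i ≠ r → j ≠ r → g' i j = g i j) :
    ∏ i ∈ range L, ∏ j ∈ Ioo i L, g' i j =
      (∏ i ∈ range L, ∏ j ∈ Ioo i L, g i j) * ∏ j ∈ (range L).erase r, ρ j := by
  have hfac : ∏ i ∈ range L, ∏ j ∈ Ioo i L, g' i j = ∏ i ∈ range L, ((∏ j ∈ Ioo i L, g i j) *
      if i = r then ∏ j ∈ Ioo r L, ρ j else if i < r then ρ i else 1) := by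
    refine prod_congr rfl fun i hi => ?_
    rcases eq_or_ne i r with rfl | hir
    · rw [if_pos rfl, ← prod_mul_distrib]
      exact prod_congr rfl fun j hj => h1 j (mem_Ioo.1 hj).1 (mem_Ioo.1 hj).2
    · rw [if_neg hir]
      split_ifs with hlt
      · have hmem : r ∈ Ioo i L := mem_Ioo.2 ⟨hlt, hr⟩
        rw [← mul_prod_erase _ _ hmem, ← mul_prod_erase _ (g i) hmem, h2 i hlt]
        have : ∏ j ∈ (Ioo i L).erase r, g' i j = ∏ j ∈ (Ioo i L).erase r, g i j :=
          prod_congr rfl fun j hj => h3 i j hir (ne_of_mem_erase hj)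
        rw [this]
        ring
      · rw [mul_one]
        refine prod_congr rfl fun j hj => h3 i j hir ?_
        have := (mem_Ioo.1 hj).1
        omega
  rw [hfac, prod_mul_distrib]
  refine congrArg₂ _ rfl ?_
  rw [← mul_prod_erase (range L) _ (mem_range.2 hr), if_pos rfl]
  have hsplit : (range L).erase r = range r ∪ Ioo r L := by
    ext j
    simp only [mem_erase, mem_union, mem_range, mem_Ioo]
    omega
  have hdisj : Disjoint (range r) (Ioo r L) := by
    rw [disjoint_left]
    intro j
    simp only [mem_range, mem_Ioo]
    omega
  rw [hsplit, prod_union hdisj, prod_union hdisj, mul_comm, mul_assoc]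
  refine congrArg₂ _ (prod_congr rfl fun j hj => ?_) ?_
  · rw [mem_range] at hj
    rw [if_neg hj.ne, if_pos hj]
  · rw [prod_eq_one fun j hj => ?_, one_mul]
    rw [mem_Ioo] at hj
    rw [if_neg (by omega), if_neg (by omega)]

/-- With `x = λ_r` and `y = λ_j`, the numerator `node r - node j` is `(x + 1 + y) (x - y) / 2` and
the denominator `node r - conode j` is `(x + y) (x + 1 - y) / 2`. -/
theorem hookProd_addBox {lam : StrictPartition} {r : ℕ} (h : lam.CanAdd r) :
    ((lam.addBox r h).hookProd : ℚ) = lam.hookProd * (lam.part r + 1) *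
      ∏ j ∈ (range (lam.length + 1)).erase r,
        ((lam.node r - lam.node j) / (lam.node r - lam.conode j)) := by
  have hr : r < lam.length + 1 := Nat.lt_succ_of_le h.le_length
  have hpart : ∀ j, j ≠ r → (lam.addBox r h).part j = lam.part j := fun j hj => by
    rw [addBox_part, if_neg hj.symm, add_zero]
  have hpart' : (lam.addBox r h).part r = lam.part r + 1 := by rw [addBox_part, if_pos rfl]
  have hne : ∀ j, j ≠ r → j < lam.length + 1 →
      (lam.part r : ℚ) - lam.part j ≠ 0 ∧ (lam.part r : ℚ) + 1 - lam.part j ≠ 0 ∧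
      (lam.part r : ℚ) + lam.part j ≠ 0 := by
    intro j hj hjl
    have h1 : lam.part r ≠ lam.part j := fun h' =>
      hj (lam.part_injOn (by simpa using hjl) (by simpa using hr) h'.symm)
    have h2 : lam.part r + 1 ≠ lam.part j := fun h' => by
      rcases lt_or_ge j r with hlt | hge
      · have := canAdd_iff.1 h j hlt
        omega
      · have h3 := part_lt_of_lt (lam := lam) (lt_of_le_of_ne hge hj.symm) (by omega)
        omega
    refine ⟨sub_ne_zero.2 (by exact_mod_cast h1), sub_ne_zero.2 (by exact_mod_cast h2), ?_⟩
    have h3 : lam.part r + lam.part j ≠ 0 := by omega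
    exact_mod_cast h3
  have hfac : ∏ i ∈ range (lam.length + 1), (((lam.addBox r h).part i).factorial : ℚ) =
      (∏ i ∈ range (lam.length + 1), ((lam.part i).factorial : ℚ)) * (lam.part r + 1) := by
    rw [← mul_prod_erase _ _ (mem_range.2 hr), ← mul_prod_erase (range (lam.length + 1))
      (fun i => ((lam.part i).factorial : ℚ)) (mem_range.2 hr), hpart', Nat.factorial_succ]
    have : ∏ i ∈ (range (lam.length + 1)).erase r, (((lam.addBox r h).part i).factorial : ℚ) =
        ∏ i ∈ (range (lam.length + 1)).erase r, ((lam.part i).factorial : ℚ) :=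
      prod_congr rfl fun i hi => by rw [hpart i (ne_of_mem_erase hi)]
    rw [this]
    push_cast
    ring
  rw [hookProd_eq _ (length_addBox_le h) (Nat.succ_le_succ (length_le_length_addBox h)), hfac,
    hookProd_eq lam (Nat.le_succ _) le_rfl,
    prod_Ioo_mul_prod_erase hr (g := fun i j => ((lam.part i : ℚ) + lam.part j) /
      (lam.part i - lam.part j)) (ρ := fun j => (lam.node r - lam.node j) /
      (lam.node r - lam.conode j))]
  · ring
  · intro j hj hjl
    obtain ⟨h1, h2, h3⟩ := hne j hj.ne' hjl
    have h4 : lam.node r - lam.conode j =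
        ((lam.part r : ℚ) + lam.part j) * (lam.part r + 1 - lam.part j) / 2 := by
      rw [node_eq, conode_eq]
      ring
    have h5 : lam.node r - lam.node j =
        ((lam.part r : ℚ) + 1 + lam.part j) * (lam.part r - lam.part j) / 2 := by
      rw [node_eq, node_eq]
      ring
    rw [h4, h5, hpart', hpart j hj.ne']
    push_cast
    field_simp
  · intro j hj
    obtain ⟨h1, h2, h3⟩ := hne j hj.ne (by omega)
    have h4 : lam.node r - lam.conode j =
        -(((lam.part j : ℚ) + lam.part r) * (lam.part j - (lam.part r + 1)) / 2) := by
      rw [node_eq, conode_eq]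
      ring
    have h5 : lam.node r - lam.node j =
        -(((lam.part j : ℚ) + (lam.part r + 1)) * (lam.part j - lam.part r) / 2) := by
      rw [node_eq, node_eq]
      ring
    have h1' : (lam.part j : ℚ) - lam.part r ≠ 0 := by
      rw [← neg_ne_zero, neg_sub]
      exact h1
    have h2' : (lam.part j : ℚ) - (lam.part r + 1) ≠ 0 := by
      rw [← neg_ne_zero, neg_sub]
      exact h2
    rw [add_comm] at h3
    rw [h4, h5, hpart', hpart j hj.ne, neg_div_neg_eq]
    push_cast
    field_simp
  · intro i j hi hj
    rw [hpart i hi, hpart j hj]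

/-- The transition weights: `2 H(λ) / H(λ^{i+})` for an existing row and `H(λ) / H(λ^{0+})` for the
new one. -/
theorem weight_of_canAdd {lam : StrictPartition} {r : ℕ} (h : lam.CanAdd r) :
    lam.weight r =
      (if r < lam.length then 2 else 1) * (lam.hookProd / (lam.addBox r h).hookProd) := by
  have hr : r < lam.length + 1 := Nat.lt_succ_of_le h.le_length
  have hH : (lam.hookProd : ℚ) ≠ 0 := by exact_mod_cast lam.hookProd_pos.ne'
  have hx : (lam.part r : ℚ) + 1 ≠ 0 := by positivity
  -- The factor `2 / (λ_r + 1)` of an existing row is `(z_r - C(λ_r, 2)) / z_r`: the numerator of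
  -- the weight includes `j = r` and omits the empty row `j = ℓ(λ)`.
  have hP : (∏ j ∈ (range (lam.length + 1)).erase r, (lam.node r - lam.conode j)) *
      (if r < lam.length then 2 else 1) =
      (∏ j ∈ range lam.length, (lam.node r - lam.conode j)) * (lam.part r + 1) := by
    rcases h.le_length.lt_or_eq with hlt | heq
    · have hpos : (lam.part r : ℚ) ≠ 0 := by exact_mod_cast (part_pos_iff.2 hlt).ne'
      rw [if_pos hlt]
      have h1 := mul_prod_erase (range (lam.length + 1))
        (fun j => lam.node r - lam.conode j) (mem_range.2 hr)
      rw [prod_range_succ] at h1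
      have h2 : lam.node r - lam.conode r = lam.part r := by
        rw [node_eq, conode_eq]
        ring
      have h3 : lam.node r - lam.conode lam.length = lam.part r * (lam.part r + 1) / 2 := by
        rw [node_eq, conode_eq, part_eq_zero_iff.2 le_rfl]
        simp
      rw [h2, h3] at h1
      refine mul_left_cancel₀ hpos ?_
      linear_combination 2 * h1
    · subst heq
      rw [if_neg (lt_irrefl _), range_add_one, erase_insert (by simp),
        part_eq_zero_iff.2 le_rfl]
      simp
  rw [hookProd_addBox h, prod_div_distrib, weight, mul_assoc, div_mul_cancel_left₀ hH, mul_inv,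
    inv_div]
  generalize ∏ j ∈ (range (lam.length + 1)).erase r, (lam.node r - lam.node j) = B
  field_simp
  linear_combination (-B⁻¹) * hP

/-- If no box can be added to a row, the weight vanishes because the previous part is
`λ_r + 1`. -/
theorem weight_of_not_canAdd {lam : StrictPartition} {r : ℕ} (hr : r ≤ lam.length)
    (h : ¬ lam.CanAdd r) : lam.weight r = 0 := by
  rw [canAdd_iff] at h
  push Not at h
  obtain ⟨j, hj, hle⟩ := h
  have hlt : lam.part r < lam.part j := by
    rcases Nat.eq_zero_or_pos (lam.part r) with h0 | h0
    · rw [h0, part_pos_iff]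
      omega
    · exact part_lt_of_lt hj h0
  have heq : lam.part j = lam.part r + 1 := by omega
  rw [weight, prod_eq_zero (mem_range.2 (show j < lam.length by omega)), zero_div]
  rw [node, conode, heq, sub_self]

/-! ### Moments of the transition weights -/

/-- The power series `1 + z u + z² u² + ⋯`, which is `1 / (1 - z u)`. -/
noncomputable def geomSeries (z : ℚ) : PowerSeries ℚ := PowerSeries.mk fun n => z ^ n

theorem one_sub_mul_geomSeries (z : ℚ) :
    (1 - PowerSeries.C z * PowerSeries.X) * geomSeries z = 1 := by
  ext n
  rw [sub_mul, one_mul, map_sub, mul_assoc, PowerSeries.coeff_C_mul]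
  cases n with
  | zero => simp [geomSeries]
  | succ n =>
    rw [PowerSeries.coeff_succ_X_mul, geomSeries, PowerSeries.coeff_mk, PowerSeries.coeff_mk,
      PowerSeries.coeff_one, if_neg (Nat.succ_ne_zero n), pow_succ']
    ring

/-- The product `∏ (1 - v_j u)` as a power series in `u`. -/
noncomputable def linProd (s : Finset ℕ) (v : ℕ → ℚ) : PowerSeries ℚ :=
  ∏ j ∈ s, (1 - PowerSeries.C (v j) * PowerSeries.X)

theorem linProd_ne_zero (s : Finset ℕ) (v : ℕ → ℚ) : linProd s v ≠ 0 :=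
  prod_ne_zero_iff.2 fun j _ h => by
    have := one_sub_mul_geomSeries (v j)
    rw [h, zero_mul] at this
    exact zero_ne_one this

/-- The logarithmic derivative of `∏ (1 - v_j u)`. -/
theorem derivative_linProd (s : Finset ℕ) (v : ℕ → ℚ) :
    PowerSeries.derivative ℚ (linProd s v) =
      - linProd s v * ∑ j ∈ s, PowerSeries.C (v j) * geomSeries (v j) := by
  induction s using Finset.induction_on with
  | empty => simp [linProd]
  | insert j s hj ih =>
    have hd : PowerSeries.derivative ℚ (1 - PowerSeries.C (v j) * PowerSeries.X) =
        - PowerSeries.C (v j) := by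
      ext n
      rw [PowerSeries.coeff_derivative]
      cases n <;> simp [PowerSeries.coeff_one, PowerSeries.coeff_C]
    have hg := one_sub_mul_geomSeries (v j)
    rw [linProd] at ih ⊢
    rw [prod_insert hj, sum_insert hj, Derivation.leibniz, ih, hd]
    simp only [smul_eq_mul]
    linear_combination (PowerSeries.C (v j) *
      ∏ j ∈ s, (1 - PowerSeries.C (v j) * PowerSeries.X)) * hg

/-- The moments of the transition weights. -/
def moment (m : ℕ) (lam : StrictPartition) : ℚ :=
  ∑ i ∈ range (lam.length + 1), lam.weight i * lam.node i ^ m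

/-- Lagrange interpolation of `∏ (t - C(λ_j, 2))` at the nodes, with `t = 1 / u`. -/
theorem sum_weight_mul_prod (lam : StrictPartition) (u : ℚ) (hu : u ≠ 0) :
    ∑ i ∈ range (lam.length + 1), lam.weight i *
        ∏ j ∈ (range (lam.length + 1)).erase i, (1 - lam.node j * u) =
      ∏ j ∈ range lam.length, (1 - lam.conode j * u) := by
  classical
  have hdeg : (Lagrange.nodal (range lam.length) lam.conode).degree <
      #(range (lam.length + 1)) := by
    rw [Lagrange.degree_nodal, card_range, card_range]
    exact_mod_cast Nat.lt_succ_self _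
  have h := congrArg (Polynomial.eval u⁻¹) (Lagrange.eq_interpolate lam.node_injOn hdeg)
  rw [Lagrange.eval_nodal, Lagrange.interpolate_apply, Polynomial.eval_finsetSum] at h
  have hl : ∏ j ∈ range lam.length, (1 - lam.conode j * u) =
      u ^ lam.length * ∏ j ∈ range lam.length, (u⁻¹ - lam.conode j) := by
    have : ∀ j ∈ range lam.length, 1 - lam.conode j * u = u * (u⁻¹ - lam.conode j) :=
      fun j _ => by field_simp
    rw [prod_congr rfl this, prod_mul_distrib, prod_const, card_range]
  rw [hl, h, mul_sum]
  refine sum_congr rfl fun i hi => ?_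
  have hr : ∏ j ∈ (range (lam.length + 1)).erase i, (1 - lam.node j * u) =
      u ^ lam.length * ∏ j ∈ (range (lam.length + 1)).erase i, (u⁻¹ - lam.node j) := by
    have : ∀ j ∈ (range (lam.length + 1)).erase i, 1 - lam.node j * u = u * (u⁻¹ - lam.node j) :=
      fun j _ => by field_simp
    rw [prod_congr rfl this, prod_mul_distrib, prod_const, card_erase_of_mem hi, card_range,
      Nat.add_sub_cancel]
  rw [hr, weight, Polynomial.eval_mul, Polynomial.eval_C, Lagrange.eval_nodal, Lagrange.basis,
    Polynomial.eval_prod]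
  simp only [Lagrange.basisDivisor, Polynomial.eval_mul, Polynomial.eval_C, Polynomial.eval_sub,
    Polynomial.eval_X, prod_mul_distrib, prod_inv_distrib]
  ring

/-- The generating function of the moments is a quotient of two products. -/
theorem mk_moment_mul_linProd (lam : StrictPartition) :
    PowerSeries.mk (fun m => moment m lam) * linProd (range (lam.length + 1)) lam.node =
      linProd (range lam.length) lam.conode := by
  classical
  have hpoly : ∑ i ∈ range (lam.length + 1), Polynomial.C (lam.weight i) *
        ∏ j ∈ (range (lam.length + 1)).erase i,
          (1 - Polynomial.C (lam.node j) * Polynomial.X) =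
      ∏ j ∈ range lam.length, (1 - Polynomial.C (lam.conode j) * Polynomial.X) := by
    refine Polynomial.eq_of_infinite_eval_eq _ _
      (Set.Infinite.mono (s := {u : ℚ | u ≠ 0}) (fun u hu => ?_)
        (Set.finite_singleton (0 : ℚ)).infinite_compl)
    have := lam.sum_weight_mul_prod u hu
    simpa [Polynomial.eval_finsetSum, Polynomial.eval_prod] using this
  have hmk : PowerSeries.mk (fun m => moment m lam) =
      ∑ i ∈ range (lam.length + 1), PowerSeries.C (lam.weight i) * geomSeries (lam.node i) := by
    ext m
    rw [PowerSeries.coeff_mk, moment, map_sum]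
    exact sum_congr rfl fun i _ => by rw [PowerSeries.coeff_C_mul, geomSeries, PowerSeries.coeff_mk]
  have h := congrArg (Polynomial.coeToPowerSeries.ringHom (R := ℚ)) hpoly
  simp only [map_sum, map_mul, map_prod, map_sub, map_one,
    Polynomial.coeToPowerSeries.ringHom_apply, Polynomial.coe_C, Polynomial.coe_X] at h
  rw [hmk, sum_mul]
  refine Eq.trans (sum_congr rfl fun i hi => ?_) h
  rw [linProd, ← mul_prod_erase _ _ hi]
  linear_combination (PowerSeries.C (lam.weight i) * ∏ j ∈ (range (lam.length + 1)).erase i,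
    (1 - PowerSeries.C (lam.node j) * PowerSeries.X)) * one_sub_mul_geomSeries (lam.node i)

theorem moment_zero (lam : StrictPartition) : moment 0 lam = 1 := by
  have h := congrArg PowerSeries.constantCoeff lam.mk_moment_mul_linProd
  simpa [linProd] using h

theorem phiPow_eq_sum_sub_sum (lam : StrictPartition) {k : ℕ} (hk : k ≠ 0) :
    lam.phiPow k = ∑ i ∈ range (lam.length + 1), lam.node i ^ k -
      ∑ i ∈ range lam.length, lam.conode i ^ k := by
  rw [phiPow_eq _ hk, sum_range_succ, node_of_length_le le_rfl, zero_pow hk, add_zero,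
    ← sum_sub_distrib]
  rfl

/-- Newton's identity, from the logarithmic derivative of the generating function: the moments are
the complete symmetric functions whose power sums are the `Φ^k`. -/
theorem succ_mul_moment_succ (m : ℕ) (lam : StrictPartition) :
    (m + 1) * moment (m + 1) lam =
      ∑ p ∈ antidiagonal m, moment p.1 lam * lam.phiPow (p.2 + 1) := by
  have hM := lam.mk_moment_mul_linProd
  set M := PowerSeries.mk (fun m => moment m lam) with hMdef
  have hA' := derivative_linProd (range lam.length) lam.conode
  have hB' := derivative_linProd (range (lam.length + 1)) lam.node
  have hd := congrArg (PowerSeries.derivative ℚ) hM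
  rw [Derivation.leibniz, hA', hB', ← hM] at hd
  simp only [smul_eq_mul] at hd
  have hPhi : ∑ j ∈ range (lam.length + 1), PowerSeries.C (lam.node j) * geomSeries (lam.node j) -
      ∑ j ∈ range lam.length, PowerSeries.C (lam.conode j) * geomSeries (lam.conode j) =
      PowerSeries.mk fun k => lam.phiPow (k + 1) := by
    ext k
    rw [PowerSeries.coeff_mk, phiPow_eq_sum_sub_sum _ (Nat.succ_ne_zero k), map_sub, map_sum,
      map_sum]
    simp only [PowerSeries.coeff_C_mul, geomSeries, PowerSeries.coeff_mk, pow_succ']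
  have key : PowerSeries.derivative ℚ M = M * PowerSeries.mk fun k => lam.phiPow (k + 1) := by
    rw [← hPhi]
    refine mul_left_cancel₀ (linProd_ne_zero (range (lam.length + 1)) lam.node) ?_
    linear_combination hd
  have := congrArg (PowerSeries.coeff m) key
  rw [PowerSeries.coeff_derivative, PowerSeries.coeff_mul, hMdef, PowerSeries.coeff_mk] at this
  rw [mul_comm, this]
  exact sum_congr rfl fun p _ => by rw [PowerSeries.coeff_mk, PowerSeries.coeff_mk]

theorem moment_mem_degLE (m : ℕ) : moment m ∈ degLE m := by
  induction m using Nat.strong_induction_on with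
  | _ m ih =>
    cases m with
    | zero =>
      convert one_mem_degLE 0 using 1
      ext lam
      exact lam.moment_zero
    | succ m =>
      have h : moment (m + 1) = ((m : ℚ) + 1)⁻¹ • ∑ p ∈ antidiagonal m,
          moment p.1 * fun lam => lam.phiPow (p.2 + 1) := by
        ext lam
        rw [Pi.smul_apply, Finset.sum_apply, smul_eq_mul]
        have := succ_mul_moment_succ m lam
        simp only [Pi.mul_apply]
        rw [← this, inv_mul_cancel_left₀ (by positivity)]
      rw [h]
      refine Submodule.smul_mem _ _ (Submodule.sum_mem _ fun p hp => ?_)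
      rw [HasAntidiagonal.mem_antidiagonal] at hp
      exact degLE_mono (by omega) (mul_mem_degLE (ih p.1 (by omega))
        (phiPow_mem_degLE (Nat.succ_ne_zero p.2)))

/-! ### The difference operator lowers the degree -/

/-- Functions of a strict partition and a number `z` that are sums of terms `f(λ) z^j` with
`deg f + j < d`. They describe how a function of degree `d` changes when a box is added to a row
with node `z`. -/
def incrementLT (d : ℕ) : Submodule ℚ (StrictPartition → ℚ → ℚ) :=
  Submodule.span ℚ {F | ∃ e j f, f ∈ degLE e ∧ e + j < d ∧ F = fun lam z => f lam * z ^ j}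

theorem incrementLT_mono {d e : ℕ} (h : d ≤ e) : incrementLT d ≤ incrementLT e :=
  Submodule.span_mono fun _ ⟨c, j, f, hf, hlt, hF⟩ => ⟨c, j, f, hf, hlt.trans_le h, hF⟩

theorem mul_mem_incrementLT {d e : ℕ} {F G : StrictPartition → ℚ → ℚ} (hF : F ∈ incrementLT d)
    (hG : G ∈ incrementLT e) : F * G ∈ incrementLT (d + e) := by
  have h : F * G ∈ incrementLT d * incrementLT e := Submodule.mul_mem_mul hF hG
  rw [incrementLT, incrementLT, Submodule.span_mul_span] at h
  refine Submodule.span_mono ?_ h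
  rintro _ ⟨_, ⟨c, j, f, hf, hj, rfl⟩, _, ⟨c', j', f', hf', hj', rfl⟩, rfl⟩
  refine ⟨c + c', j + j', f * f', mul_mem_degLE hf hf', by omega, ?_⟩
  ext lam z
  simp only [Pi.mul_apply, pow_add]
  ring

theorem degLE_mul_mem_incrementLT {d e : ℕ} {f : StrictPartition → ℚ}
    {G : StrictPartition → ℚ → ℚ} (hf : f ∈ degLE d) (hG : G ∈ incrementLT e) :
    (fun lam z => f lam * G lam z) ∈ incrementLT (d + e) := by
  induction hG using Submodule.span_induction with
  | mem G hG =>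
    obtain ⟨c, j, g, hg, hj, rfl⟩ := hG
    refine Submodule.subset_span ⟨d + c, j, f * g, mul_mem_degLE hf hg, by omega, ?_⟩
    ext lam z
    simp only [Pi.mul_apply]
    ring
  | zero =>
    simp only [Pi.zero_apply, mul_zero]
    exact Submodule.zero_mem _
  | add G G' _ _ h h' =>
    simp only [Pi.add_apply, mul_add]
    exact Submodule.add_mem _ h h'
  | smul c G _ h =>
    simp only [Pi.smul_apply, smul_eq_mul, mul_left_comm _ c]
    exact Submodule.smul_mem _ c h

theorem eval_mem_incrementLT {k : ℕ} {p : Polynomial ℚ} (hp : p.natDegree ≤ k) :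
    (fun (_ : StrictPartition) z => p.eval z) ∈ incrementLT (k + 1) := by
  have h : (fun (_ : StrictPartition) z => p.eval z) =
      ∑ j ∈ range (p.natDegree + 1), fun _ z => p.coeff j * z ^ j := by
    ext lam z
    rw [Polynomial.eval_eq_sum_range, Finset.sum_apply, Finset.sum_apply]
  rw [h]
  refine Submodule.sum_mem _ fun j hj => ?_
  rw [mem_range] at hj
  exact Submodule.smul_mem _ (p.coeff j) (Submodule.subset_span
    ⟨0, j, 1, one_mem_degLE 0, by omega, by ext; simp⟩)

/-- `(x + 1)^n + (-x)^n` is symmetric under `x ↦ -1 - x`, hence a polynomial of degree at most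
`n / 2` in `x (x + 1) / 2`. -/
theorem exists_polynomial_pow_add_neg_pow (n : ℕ) :
    ∃ p : Polynomial ℚ, p.natDegree ≤ n / 2 ∧
      ∀ x : ℚ, p.eval (x * (x + 1) / 2) = (x + 1) ^ n + (-x) ^ n := by
  induction n using Nat.twoStepInduction with
  | zero => exact ⟨2, by simp, fun x => by norm_num⟩
  | one => exact ⟨1, by simp, fun x => by norm_num⟩
  | more n ih0 ih1 =>
    obtain ⟨p, hp, hp'⟩ := ih0
    obtain ⟨q, hq, hq'⟩ := ih1
    refine ⟨q + Polynomial.C 2 * Polynomial.X * p, ?_, fun x => ?_⟩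
    · refine (Polynomial.natDegree_add_le _ _).trans (max_le (by omega) ?_)
      have h1 := Polynomial.natDegree_mul_le (p := Polynomial.C (2 : ℚ) * Polynomial.X) (q := p)
      have h2 : (Polynomial.C (2 : ℚ) * Polynomial.X).natDegree ≤ 1 :=
        (Polynomial.natDegree_C_mul_le _ _).trans Polynomial.natDegree_X_le
      omega
    · simp only [Polynomial.eval_add, Polynomial.eval_mul, Polynomial.eval_C, Polynomial.eval_X,
        hp', hq']
      ring

theorem oddSum_addBox (k : ℕ) {lam : StrictPartition} {i : ℕ} (h : lam.CanAdd i) :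
    oddSum k (lam.addBox i h) = oddSum k lam +
      (((lam.part i : ℚ) + 1) ^ (2 * k + 1) + (-(lam.part i : ℚ)) ^ (2 * k + 1)) := by
  have hi : i ∈ range (lam.length + 1) := mem_range.2 (Nat.lt_succ_of_le h.le_length)
  rw [oddSum_eq k _ (length_addBox_le h), oddSum_eq k lam (Nat.le_succ _),
    ← add_sum_erase _ _ hi, ← add_sum_erase (range (lam.length + 1))
      (fun i => (lam.part i : ℚ) ^ (2 * k + 1)) hi, addBox_part, if_pos rfl,
    (odd_two_mul_add_one k).neg_pow]
  have : ∑ j ∈ (range (lam.length + 1)).erase i, ((lam.addBox i h).part j : ℚ) ^ (2 * k + 1) =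
      ∑ j ∈ (range (lam.length + 1)).erase i, (lam.part j : ℚ) ^ (2 * k + 1) :=
    sum_congr rfl fun j hj => by
      rw [addBox_part, if_neg (ne_of_mem_erase hj).symm, add_zero]
  rw [this]
  push_cast
  ring

/-- Adding a box to a row changes a function of degree at most `d` by a polynomial in the node of
the row, of total degree less than `d`. -/
theorem exists_increment {d : ℕ} {f : StrictPartition → ℚ} (hf : f ∈ degLE d) :
    ∃ F ∈ incrementLT d, ∀ (lam : StrictPartition) (i : ℕ) (h : lam.CanAdd i),
      f (lam.addBox i h) = f lam + F lam (lam.node i) := by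
  have hprod : ∀ s : Multiset ℕ, ∃ F ∈ incrementLT (s.map (· + 1)).sum,
      ∀ (lam : StrictPartition) (i : ℕ) (h : lam.CanAdd i),
        (s.map oddSum).prod (lam.addBox i h) = (s.map oddSum).prod lam + F lam (lam.node i) := by
    intro s
    induction s using Multiset.induction_on with
    | empty => exact ⟨0, Submodule.zero_mem _, by simp⟩
    | cons k s ih =>
      obtain ⟨G, hG, hG'⟩ := ih
      obtain ⟨p, hp, hp'⟩ := exists_polynomial_pow_add_neg_pow (2 * k + 1)
      rw [show (2 * k + 1) / 2 = k by omega] at hp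
      have hP := eval_mem_incrementLT hp
      have hs : (s.map oddSum).prod ∈ degLE (s.map (· + 1)).sum :=
        Submodule.subset_span ⟨s, le_rfl, rfl⟩
      have h1 := degLE_mul_mem_incrementLT (oddSum_mem_degLE k) hG
      have h2 := degLE_mul_mem_incrementLT hs hP
      have h3 := mul_mem_incrementLT hP hG
      rw [add_comm] at h2
      rw [Multiset.map_cons, Multiset.sum_cons]
      refine ⟨_, Submodule.add_mem _ (Submodule.add_mem _ h1 h2) h3, fun lam i h => ?_⟩
      rw [Multiset.map_cons, Multiset.prod_cons]
      simp only [Pi.mul_apply, Pi.add_apply]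
      rw [hG' lam i h, oddSum_addBox k h, ← hp', ← node_eq]
      ring
  induction hf using Submodule.span_induction with
  | mem f hf =>
    obtain ⟨s, hs, rfl⟩ := hf
    obtain ⟨F, hF, h⟩ := hprod s
    exact ⟨F, incrementLT_mono hs hF, h⟩
  | zero => exact ⟨0, Submodule.zero_mem _, by simp⟩
  | add f g _ _ hf hg =>
    obtain ⟨F, hF, h⟩ := hf
    obtain ⟨G, hG, h'⟩ := hg
    refine ⟨F + G, Submodule.add_mem _ hF hG, fun lam i hi => ?_⟩
    simp only [Pi.add_apply, h lam i hi, h' lam i hi]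
    ring
  | smul c f _ hf =>
    obtain ⟨F, hF, h⟩ := hf
    refine ⟨c • F, Submodule.smul_mem _ c hF, fun lam i hi => ?_⟩
    simp only [Pi.smul_apply, smul_eq_mul, h lam i hi]
    ring

theorem incrementLT_zero : incrementLT 0 = ⊥ := by
  rw [incrementLT, Submodule.span_eq_bot]
  rintro _ ⟨e, j, f, -, h, -⟩
  omega

theorem sum_weight_mul_mem_degLE {d : ℕ} {F : StrictPartition → ℚ → ℚ}
    (hF : F ∈ incrementLT (d + 1)) :
    (fun lam : StrictPartition =>
      ∑ i ∈ range (lam.length + 1), lam.weight i * F lam (lam.node i)) ∈ degLE d := by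
  induction hF using Submodule.span_induction with
  | mem F hF =>
    obtain ⟨e, j, f, hf, hj, rfl⟩ := hF
    convert degLE_mono (show e + j ≤ d by omega) (mul_mem_degLE hf (moment_mem_degLE j)) using 1
    ext lam
    rw [Pi.mul_apply, moment, mul_sum]
    exact sum_congr rfl fun i _ => by ring
  | zero =>
    simp only [Pi.zero_apply, mul_zero, sum_const_zero]
    exact Submodule.zero_mem _
  | add F G _ _ h h' =>
    simp only [Pi.add_apply, mul_add, sum_add_distrib]
    exact Submodule.add_mem _ h h'
  | smul c F _ h =>
    simp only [Pi.smul_apply, smul_eq_mul, mul_left_comm _ c, ← mul_sum]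
    exact Submodule.smul_mem _ c h

/-- Quotients by `H` turn `D` into averaging over the transition weights. -/
theorem diffOp_div_hookProd (f : StrictPartition → ℚ) (F : StrictPartition → ℚ → ℚ)
    (hF : ∀ (lam : StrictPartition) (i : ℕ) (h : lam.CanAdd i),
      f (lam.addBox i h) = f lam + F lam (lam.node i)) (lam : StrictPartition) :
    diffOp (fun rho => f rho / rho.hookProd) lam =
      (∑ i ∈ range (lam.length + 1), lam.weight i * F lam (lam.node i)) / lam.hookProd := by
  classical
  have hH : (lam.hookProd : ℚ) ≠ 0 := by exact_mod_cast lam.hookProd_pos.ne'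
  have hterm : ∀ i ≤ lam.length,
      (if i < lam.length then (2 : ℚ) else 1) *
        (if h : lam.CanAdd i then f (lam.addBox i h) / (lam.addBox i h).hookProd else 0) =
      lam.weight i * (f lam + F lam (lam.node i)) / lam.hookProd := by
    intro i hi
    by_cases h : lam.CanAdd i
    · rw [dif_pos h, weight_of_canAdd h, hF lam i h]
      field_simp
    · rw [dif_neg h, weight_of_not_canAdd hi h]
      simp
  have h1 := sum_congr (rfl : range (lam.length + 1) = _)
    fun i hi => hterm i (Nat.lt_succ_iff.1 (mem_range.1 hi))
  rw [sum_range_succ, if_neg (lt_irrefl _), one_mul] at h1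
  have h2 : ∑ i ∈ range lam.length, (if i < lam.length then (2 : ℚ) else 1) *
        (if h : lam.CanAdd i then f (lam.addBox i h) / (lam.addBox i h).hookProd else 0) =
      2 * ∑ i ∈ range lam.length,
        if h : lam.CanAdd i then f (lam.addBox i h) / (lam.addBox i h).hookProd else 0 := by
    rw [mul_sum]
    exact sum_congr rfl fun i hi => by rw [if_pos (mem_range.1 hi)]
  have h3 := lam.moment_zero
  simp only [moment, pow_zero, mul_one] at h3
  rw [h2] at h1
  rw [diffOp, h1, ← sum_div]
  simp only [mul_add, sum_add_distrib, ← sum_mul]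
  rw [h3]
  ring

theorem diffOp_div_hookProd_of_mem_degLE_zero {f : StrictPartition → ℚ} (hf : f ∈ degLE 0) :
    diffOp (fun rho => f rho / rho.hookProd) = 0 := by
  obtain ⟨F, hF, h⟩ := exists_increment hf
  rw [incrementLT_zero, Submodule.mem_bot] at hF
  subst hF
  ext lam
  rw [diffOp_div_hookProd f 0 h]
  simp

theorem exists_diffOp_div_hookProd_eq {d : ℕ} {f : StrictPartition → ℚ} (hf : f ∈ degLE (d + 1)) :
    ∃ g ∈ degLE d, diffOp (fun rho => f rho / rho.hookProd) = fun rho => g rho / rho.hookProd := by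
  obtain ⟨F, hF, h⟩ := exists_increment hf
  exact ⟨_, sum_weight_mul_mem_degLE hF, funext fun lam => diffOp_div_hookProd f F h lam⟩

/-- Each application of `D` lowers the degree of the numerator. -/
theorem diffOp_iterate_div_hookProd {d : ℕ} {f : StrictPartition → ℚ} (hf : f ∈ degLE d) :
    diffOp^[d + 1] (fun rho => f rho / rho.hookProd) = 0 := by
  induction d generalizing f with
  | zero => exact diffOp_div_hookProd_of_mem_degLE_zero hf
  | succ d ih =>
    obtain ⟨g, hg, h⟩ := exists_diffOp_div_hookProd_eq hf
    rw [Function.iterate_succ_apply, h, ih hg]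

/-! ### Skew tableaux and iterates of the difference operator -/

/-- The relation between boxes along which the entries of a tableau increase. -/
def boxLT (c d : ℕ × ℕ) : Prop := (c.1 = d.1 ∧ c.2 < d.2) ∨ (c.2 = d.2 ∧ c.1 < d.1)

/-- Fillings of a set of boxes by `0, …, n - 1`, each used once, increasing along rows and
columns. -/
def Labeling (A : Finset (ℕ × ℕ)) (n : ℕ) : Type :=
  {T : A ≃ Fin n // ∀ c d : A, boxLT c.1 d.1 → T c < T d}

instance (A : Finset (ℕ × ℕ)) (n : ℕ) : Finite (Labeling A n) :=
  inferInstanceAs (Finite {T : A ≃ Fin n // ∀ c d : A, boxLT c.1 d.1 → T c < T d})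

theorem numTableaux_eq (lam mu : StrictPartition) :
    lam.numTableaux mu = Nat.card (Labeling (lam.skewCells mu) (lam.skewCells mu).card) := rfl

/-- Removing the box `c` with entry `0` from a filling. -/
def removeZero {A : Finset (ℕ × ℕ)} {n : ℕ} {c : ℕ × ℕ} (hc : c ∈ A) (e : A ≃ Fin (n + 1))
    (h : e ⟨c, hc⟩ = 0) : A.erase c ≃ Fin n where
  toFun x := (e ⟨x, mem_of_mem_erase x.2⟩).pred fun h0 => by
    have := congrArg Subtype.val (e.injective (h0.trans h.symm))
    exact ne_of_mem_erase x.2 this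
  invFun k := ⟨e.symm k.succ, mem_erase.2 ⟨fun h0 => by
    have h1 : e.symm k.succ = ⟨c, hc⟩ := Subtype.ext h0
    rw [Equiv.symm_apply_eq, h] at h1
    exact Fin.succ_ne_zero k h1, Subtype.prop _⟩⟩
  left_inv x := by simp
  right_inv k := by simp

/-- Adding the box `c` with entry `0` to a filling. -/
def insertZero {A : Finset (ℕ × ℕ)} {n : ℕ} {c : ℕ × ℕ} (hc : c ∈ A) (e : A.erase c ≃ Fin n) :
    A ≃ Fin (n + 1) where
  toFun x := if h : x.1 = c then 0 else (e ⟨x, mem_erase.2 ⟨h, x.2⟩⟩).succ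
  invFun k := Fin.cases ⟨c, hc⟩ (fun k => ⟨e.symm k, mem_of_mem_erase (e.symm k).2⟩) k
  left_inv x := by
    by_cases h : x.1 = c
    · simp only [dif_pos h]
      exact Subtype.ext h.symm
    · simp [dif_neg h]
  right_inv k := by
    cases k using Fin.cases with
    | zero => simp
    | succ k =>
      have : (e.symm k).1 ≠ c := ne_of_mem_erase (e.symm k).2
      simp [this]

/-- The fillings with entry `0` in a minimal box are those of the remaining boxes. -/
def labelingEquiv {A : Finset (ℕ × ℕ)} {n : ℕ} {c : ℕ × ℕ} (hc : c ∈ A)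
    (hmin : ∀ d ∈ A, ¬ boxLT d c) :
    {T : Labeling A (n + 1) // T.1 ⟨c, hc⟩ = 0} ≃ Labeling (A.erase c) n where
  toFun T := ⟨removeZero hc T.1.1 T.2, fun x y hxy => by
    rw [removeZero, Equiv.coe_fn_mk, Fin.pred_lt_pred_iff]
    exact T.1.2 ⟨x, mem_of_mem_erase x.2⟩ ⟨y, mem_of_mem_erase y.2⟩ hxy⟩
  invFun T := ⟨⟨insertZero hc T.1, fun x y hxy => by
    have hy : y.1 ≠ c := fun h => hmin x x.2 (h ▸ hxy)
    by_cases hx : x.1 = c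
    · simp [insertZero, hx, hy, Fin.succ_pos]
    · simp only [insertZero, Equiv.coe_fn_mk, dif_neg hx, dif_neg hy, Fin.succ_lt_succ_iff]
      exact T.2 _ _ hxy⟩, by simp [insertZero]⟩
  left_inv T := by
    refine Subtype.ext (Subtype.ext (Equiv.ext fun x => ?_))
    by_cases hx : x.1 = c
    · have : x = ⟨c, hc⟩ := Subtype.ext hx
      subst this
      rw [T.2]
      simp [insertZero]
    · simp [insertZero, removeZero, hx]
  right_inv T := by
    refine Subtype.ext (Equiv.ext fun x => ?_)
    have : x.1 ≠ c := ne_of_mem_erase x.2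
    simp [insertZero, removeZero, this]

open Classical in
theorem card_labeling_succ (A : Finset (ℕ × ℕ)) (n : ℕ) :
    Nat.card (Labeling A (n + 1)) =
      ∑ c ∈ A with ∀ d ∈ A, ¬ boxLT d c, Nat.card (Labeling (A.erase c) n) := by
  set B := {c ∈ A | ∀ d ∈ A, ¬ boxLT d c} with hB
  have hmem : ∀ T : Labeling A (n + 1), (T.1.symm 0).1 ∈ B := fun T => by
    refine mem_filter.2 ⟨(T.1.symm 0).2, fun d hd hlt => ?_⟩
    have := T.2 ⟨d, hd⟩ (T.1.symm 0) hlt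
    simp at this
  let f : Labeling A (n + 1) → B := fun T => ⟨(T.1.symm 0).1, hmem T⟩
  rw [← Nat.card_congr (Equiv.sigmaFiberEquiv f), Nat.card_sigma,
    ← sum_coe_sort B fun c => Nat.card (Labeling (A.erase c) n)]
  refine sum_congr rfl fun c _ => ?_
  obtain ⟨hcA, hmin⟩ := mem_filter.1 c.2
  rw [← Nat.card_congr (labelingEquiv (n := n) hcA hmin)]
  refine Nat.card_congr (Equiv.subtypeEquivRight fun T => ?_)
  rw [Subtype.ext_iff, ← Equiv.eq_symm_apply, Subtype.ext_iff, eq_comm]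

theorem card_cells (lam : StrictPartition) : #lam.cells = lam.size := by
  rw [card_eq_sum_ones, sum_finset_product lam.cells (range lam.length)
    (fun i => Ioc i (i + lam.part i)), size_eq_sum lam le_rfl]
  · simp
  · rintro ⟨i, c⟩
    simp only [mem_cells, mem_range, mem_Ioc, ← part_pos_iff]
    omega

theorem cells_subset {lam mu : StrictPartition} (h : mu.part ≤ lam.part) :
    mu.cells ⊆ lam.cells := by
  rintro ⟨i, c⟩
  have := h i
  simp only [mem_cells]
  omega

theorem cells_addBox {lam : StrictPartition} {i : ℕ} (h : lam.CanAdd i) :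
    (lam.addBox i h).cells = insert (i, i + lam.part i + 1) lam.cells := by
  ext ⟨k, c⟩
  simp only [mem_cells, mem_insert, addBox_part, Prod.mk.injEq]
  split_ifs with hik
  · subst hik
    omega
  · omega

theorem card_skewCells {lam mu : StrictPartition} (h : mu.part ≤ lam.part) {n : ℕ}
    (hn : lam.size = mu.size + n) : #(lam.skewCells mu) = n := by
  rw [skewCells, card_sdiff_of_subset (cells_subset h), card_cells, card_cells]
  omega

theorem part_le_part_addBox {lam : StrictPartition} {i : ℕ} (h : lam.CanAdd i) :
    lam.part ≤ (lam.addBox i h).part := fun j => by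
  rw [addBox_part]
  omega

/-- The possible positions of the smallest entry of a tableau of shape `λ/μ` are the boxes that
can be added to `μ` inside `λ`. -/
theorem minimal_skewCells_iff {lam mu : StrictPartition} (hle : mu.part ≤ lam.part) {c : ℕ × ℕ} :
    (c ∈ lam.skewCells mu ∧ ∀ d ∈ lam.skewCells mu, ¬ boxLT d c) ↔
      ∃ h : mu.CanAdd c.1, (mu.addBox c.1 h).part ≤ lam.part ∧ c.2 = c.1 + mu.part c.1 + 1 := by
  obtain ⟨i, j⟩ := c
  simp only [skewCells, mem_sdiff, mem_cells]
  constructor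
  · rintro ⟨⟨h1, h2⟩, hmin⟩
    -- Otherwise the left neighbour of the box would be smaller.
    have hj : j = i + mu.part i + 1 := by
      by_contra hj
      refine hmin (i, j - 1) ?_ (Or.inl ⟨rfl, ?_⟩)
      · simp only
        omega
      · simp only
        omega
    -- Otherwise the box of the same column in a row `k < i` would be smaller.
    have hadd : mu.CanAdd i := canAdd_iff.2 fun k hk => by
      by_contra hle'
      have h3 := add_part_le (lam := lam) hk.le (by omega)
      refine hmin (k, j) ?_ (Or.inr ⟨rfl, hk⟩)
      simp only
      omega
    refine ⟨hadd, fun k => ?_, hj⟩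
    rw [addBox_part]
    split_ifs with hik
    · subst hik
      omega
    · exact hle k
  · rintro ⟨h, hle', hj⟩
    have h1 := hle' i
    rw [addBox_part, if_pos rfl] at h1
    refine ⟨by omega, ?_⟩
    rintro ⟨k, l⟩ hd (⟨h2, h3⟩ | ⟨h2, h3⟩)
    · simp only at hd h2 h3
      subst h2
      omega
    · simp only at hd h2 h3
      have h4 := add_part_le (lam := mu.addBox i h) h3.le (by rw [addBox_part, if_pos rfl]; omega)
      rw [addBox_part, addBox_part, if_pos rfl, if_neg h3.ne'] at h4
      omega

theorem skewCells_addBox {lam mu : StrictPartition} {i : ℕ} (h : mu.CanAdd i) :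
    lam.skewCells (mu.addBox i h) = (lam.skewCells mu).erase (i, i + mu.part i + 1) := by
  rw [skewCells, skewCells, cells_addBox h]
  ext c
  simp only [mem_sdiff, mem_insert, mem_erase]
  tauto

open Classical in
theorem numTableaux_eq_sum {lam mu : StrictPartition} (hle : mu.part ≤ lam.part) {n : ℕ}
    (hn : lam.size = mu.size + (n + 1)) :
    lam.numTableaux mu = ∑ i ∈ range (mu.length + 1), if h : mu.CanAdd i then
      if (mu.addBox i h).part ≤ lam.part then lam.numTableaux (mu.addBox i h) else 0 else 0 := by
  rw [numTableaux_eq, card_skewCells hle hn, card_labeling_succ]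
  have hL : ∀ i : ℕ, (if h : mu.CanAdd i then
      if (mu.addBox i h).part ≤ lam.part then lam.numTableaux (mu.addBox i h) else 0 else 0) =
      if ∃ h : mu.CanAdd i, (mu.addBox i h).part ≤ lam.part then
        Nat.card (Labeling ((lam.skewCells mu).erase (i, i + mu.part i + 1)) n) else 0 := by
    intro i
    by_cases h : mu.CanAdd i
    · by_cases h' : (mu.addBox i h).part ≤ lam.part
      · rw [dif_pos h, if_pos h', if_pos ⟨h, h'⟩, numTableaux_eq,
          card_skewCells (n := n) h' (by rw [size_addBox]; omega), skewCells_addBox]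
      · rw [dif_pos h, if_neg h', if_neg fun ⟨_, h2⟩ => h' h2]
    · rw [dif_neg h, if_neg fun ⟨h1, _⟩ => h h1]
  rw [sum_congr rfl fun i _ => hL i, ← sum_filter]
  refine sum_bij' (fun c _ => c.1) (fun i _ => (i, i + mu.part i + 1)) ?_ ?_ ?_ ?_ ?_
  · intro c hc
    obtain ⟨h, h1, h2⟩ := (minimal_skewCells_iff hle).1 (mem_filter.1 hc)
    exact mem_filter.2 ⟨mem_range.2 (Nat.lt_succ_of_le h.le_length), h, h1⟩
  · intro i hi
    obtain ⟨h, h1⟩ := (mem_filter.1 hi).2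
    exact mem_filter.2 ((minimal_skewCells_iff hle).2 ⟨h, h1, rfl⟩)
  · intro c hc
    obtain ⟨h, h1, h2⟩ := (minimal_skewCells_iff hle).1 (mem_filter.1 hc)
    exact Prod.ext rfl h2.symm
  · intro i hi
    rfl
  · intro c hc
    obtain ⟨h, h1, h2⟩ := (minimal_skewCells_iff hle).1 (mem_filter.1 hc)
    rw [show (c.1, c.1 + mu.part c.1 + 1) = c from Prod.ext rfl h2.symm]

theorem mem_extensions {mu lam : StrictPartition} {n : ℕ} :
    lam ∈ mu.extensions n ↔ mu.part ≤ lam.part ∧ lam.size = mu.size + n := by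
  simp [extensions]

open Classical in
theorem extensions_addBox {mu : StrictPartition} {i : ℕ} (h : mu.CanAdd i) (n : ℕ) :
    (mu.addBox i h).extensions n =
      {lam ∈ mu.extensions (n + 1) | (mu.addBox i h).part ≤ lam.part} := by
  ext lam
  simp only [mem_extensions, mem_filter, size_addBox]
  constructor
  · rintro ⟨h1, h2⟩
    exact ⟨⟨(part_le_part_addBox h).trans h1, by omega⟩, h1⟩
  · rintro ⟨⟨-, h2⟩, h1⟩
    exact ⟨h1, by omega⟩

theorem extensions_zero (mu : StrictPartition) : mu.extensions 0 = {mu} := by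
  ext lam
  rw [mem_extensions, mem_singleton, add_zero]
  constructor
  · rintro ⟨h1, h2⟩
    have hcells : mu.cells = lam.cells :=
      eq_of_subset_of_card_le (cells_subset h1) (by rw [card_cells, card_cells, h2])
    refine StrictPartition.ext (Finsupp.ext fun i => le_antisymm ?_ (h1 i))
    rcases Nat.eq_zero_or_pos (lam.part i) with h0 | h0
    · omega
    · have : (i, i + lam.part i) ∈ mu.cells := by
        rw [hcells, mem_cells]
        simp only
        omega
      rw [mem_cells] at this
      simp only at this
      omega
  · rintro rfl
    exact ⟨le_rfl, rfl⟩

theorem numTableaux_self (mu : StrictPartition) : mu.numTableaux mu = 1 := by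
  have h : mu.skewCells mu = ∅ := by rw [skewCells, sdiff_self]; rfl
  rw [numTableaux_eq, h, card_empty]
  refine Nat.card_eq_one_iff_unique.2 ⟨⟨fun S T => Subtype.ext (Equiv.ext fun x => ?_)⟩, ?_⟩
  · exact absurd x.2 (notMem_empty _)
  · exact ⟨⟨Equiv.equivOfIsEmpty _ _, fun c => absurd c.2 (notMem_empty _)⟩⟩

/-- The difference operator as a linear map. -/
noncomputable def diffOpLinear : Module.End ℚ (StrictPartition → ℚ) where
  toFun := diffOp
  map_add' f g := by
    classical
    ext lam
    have : ∀ i, (if h : lam.CanAdd i then (f + g) (lam.addBox i h) else 0) =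
        (if h : lam.CanAdd i then f (lam.addBox i h) else 0) +
          if h : lam.CanAdd i then g (lam.addBox i h) else 0 := fun i => by
      split_ifs <;> simp
    rw [Pi.add_apply]
    simp only [diffOp, this, sum_add_distrib]
    rw [Pi.add_apply]
    ring
  map_smul' c f := by
    classical
    ext lam
    have : ∀ i, (if h : lam.CanAdd i then (c • f) (lam.addBox i h) else 0) =
        c * if h : lam.CanAdd i then f (lam.addBox i h) else 0 := fun i => by
      split_ifs <;> simp
    rw [RingHom.id_apply, Pi.smul_apply]
    simp only [diffOp, this, ← mul_sum, smul_eq_mul]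
    rw [Pi.smul_apply, smul_eq_mul]
    ring

theorem diffOpLinear_pow_apply (k : ℕ) (g : StrictPartition → ℚ) :
    (diffOpLinear ^ k) g = diffOp^[k] g := by
  rw [Module.End.pow_apply]
  rfl

open Classical in
theorem diffOpLinear_add_one_apply (g : StrictPartition → ℚ) (mu : StrictPartition) :
    (diffOpLinear + 1) g mu = ∑ i ∈ range (mu.length + 1),
      (if i < mu.length then 2 else 1) * if h : mu.CanAdd i then g (mu.addBox i h) else 0 := by
  rw [sum_range_succ, if_neg (lt_irrefl _), one_mul]
  have : ∑ i ∈ range mu.length, (if i < mu.length then (2 : ℚ) else 1) *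
        (if h : mu.CanAdd i then g (mu.addBox i h) else 0) =
      2 * ∑ i ∈ range mu.length, if h : mu.CanAdd i then g (mu.addBox i h) else 0 := by
    rw [mul_sum]
    exact sum_congr rfl fun i hi => by rw [if_pos (mem_range.1 hi)]
  rw [this]
  exact sub_add_cancel _ _

theorem two_pow_addBox {mu : StrictPartition} {i : ℕ} (h : mu.CanAdd i) :
    (2 : ℚ) ^ ((mu.addBox i h).size - (mu.addBox i h).length) =
      2 ^ (mu.size - mu.length) * if i < mu.length then 2 else 1 := by
  have h1 := mu.length_le_size
  rw [size_addBox]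
  rcases h.le_length.lt_or_eq with hi | rfl
  · rw [length_addBox_of_lt h hi, if_pos hi, ← pow_succ]
    congr 1
    omega
  · rw [length_addBox_length h, if_neg (lt_irrefl _), mul_one]
    congr 1
    omega

/-- Sums over tableaux are iterates of `D + 1`: a tableau of shape `λ/μ` is a sequence of single
boxes leading from `μ` to `λ`, and all these sequences carry the same power of `2`. -/
theorem sum_extensions_eq (g : StrictPartition → ℚ) (n : ℕ) (mu : StrictPartition) :
    ∑ lam ∈ mu.extensions n, (2 : ℚ) ^ (lam.size - lam.length) * lam.numTableaux mu * g lam =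
      2 ^ (mu.size - mu.length) * ((diffOpLinear + 1) ^ n) g mu := by
  classical
  induction n generalizing mu with
  | zero =>
    rw [extensions_zero, sum_singleton, numTableaux_self, Nat.cast_one, mul_one, pow_zero]
    rfl
  | succ n ih =>
    rw [pow_succ', Module.End.mul_apply, diffOpLinear_add_one_apply, mul_sum]
    have h1 : ∀ lam ∈ mu.extensions (n + 1),
        (2 : ℚ) ^ (lam.size - lam.length) * lam.numTableaux mu * g lam =
        ∑ i ∈ range (mu.length + 1), if h : mu.CanAdd i then
          if (mu.addBox i h).part ≤ lam.part then
            (2 : ℚ) ^ (lam.size - lam.length) * lam.numTableaux (mu.addBox i h) * g lam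
          else 0 else 0 := fun lam hlam => by
      rw [mem_extensions] at hlam
      rw [numTableaux_eq_sum hlam.1 hlam.2, Nat.cast_sum, mul_sum, sum_mul]
      refine sum_congr rfl fun i _ => ?_
      split_ifs <;> simp
    rw [sum_congr rfl h1, sum_comm]
    refine sum_congr rfl fun i _ => ?_
    by_cases h : mu.CanAdd i
    · simp only [dif_pos h]
      rw [← sum_filter, ← extensions_addBox h, ih, two_pow_addBox h]
      ring
    · simp only [dif_neg h, sum_const_zero, mul_zero]

/-- If `D^(d+1) g = 0`, then `(D + 1)^n g = ∑ C(n, k) D^k g` is a polynomial in `n` of degree at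
most `d`. -/
theorem exists_polynomial_sum_extensions {d : ℕ} {g : StrictPartition → ℚ}
    (hg : diffOp^[d + 1] g = 0) (mu : StrictPartition) :
    ∃ P : Polynomial ℚ, P.natDegree ≤ d ∧ ∀ n : ℕ,
      ∑ lam ∈ mu.extensions n, (2 : ℚ) ^ (lam.size - lam.length) * lam.numTableaux mu * g lam =
        P.eval (n : ℚ) := by
  refine ⟨Polynomial.C (2 ^ (mu.size - mu.length)) * ∑ k ∈ range (d + 1),
    Polynomial.C (diffOp^[k] g mu / (k.factorial : ℚ)) * descPochhammer ℚ k, ?_, fun n => ?_⟩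
  · refine (Polynomial.natDegree_C_mul_le _ _).trans
      (Polynomial.natDegree_sum_le_of_forall_le _ _ fun k hk => ?_)
    refine (Polynomial.natDegree_C_mul_le _ _).trans ?_
    rw [descPochhammer_natDegree]
    exact Nat.lt_succ_iff.1 (mem_range.1 hk)
  · have hzero : ∀ k, d + 1 ≤ k → diffOp^[k] g mu = 0 := fun k hk => by
      rw [← Nat.sub_add_cancel hk, Function.iterate_add_apply, hg, ← diffOpLinear_pow_apply,
        map_zero, Pi.zero_apply]
    have hpow : ((diffOpLinear + 1) ^ n) g mu =
        ∑ k ∈ range (n + 1), (n.choose k : ℚ) * diffOp^[k] g mu := by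
      rw [(Commute.one_right diffOpLinear).add_pow, LinearMap.sum_apply, Finset.sum_apply]
      refine sum_congr rfl fun k _ => ?_
      rw [one_pow, mul_one, Module.End.mul_apply, ← diffOpLinear_pow_apply, ← nsmul_eq_mul,
        Module.End.natCast_apply, map_nsmul]
      rfl
    have h1 : ∑ k ∈ range (n + 1), (n.choose k : ℚ) * diffOp^[k] g mu =
        ∑ k ∈ range (max n d + 1), (n.choose k : ℚ) * diffOp^[k] g mu := by
      refine sum_subset (range_mono (by omega)) fun k _ hk => ?_
      rw [Nat.choose_eq_zero_of_lt (by simpa using hk), Nat.cast_zero, zero_mul]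
    have h2 : ∑ k ∈ range (d + 1), (n.choose k : ℚ) * diffOp^[k] g mu =
        ∑ k ∈ range (max n d + 1), (n.choose k : ℚ) * diffOp^[k] g mu := by
      refine sum_subset (range_mono (by omega)) fun k _ hk => ?_
      rw [hzero k (by simpa using hk), mul_zero]
    rw [sum_extensions_eq, hpow, h1, ← h2, Polynomial.eval_mul, Polynomial.eval_C,
      Polynomial.eval_finsetSum]
    refine congrArg₂ _ rfl (sum_congr rfl fun k _ => ?_)
    rw [Polynomial.eval_mul, Polynomial.eval_C, descPochhammer_eval_eq_descFactorial,
      Nat.descFactorial_eq_factorial_mul_choose]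
    have : (k.factorial : ℚ) ≠ 0 := by positivity
    push_cast
    field_simp

end StrictPartition

theorem mainTheorem6 {a b : ℕ} (nu : a.Partition) (delta : b.Partition) :
    (∀ lam : StrictPartition,
      (StrictPartition.diffOp^[b + delta.parts.card + a + 1]
        (fun rho => rho.hookPowProd delta * rho.phi nu / (rho.hookProd : ℚ))) lam = 0) ∧
    (∀ mu : StrictPartition, ∃ P : Polynomial ℚ,
      P.natDegree ≤ b + delta.parts.card ∧
      ∀ n : ℕ,
        ∑ lam ∈ mu.extensions n,
          (2 : ℚ) ^ (lam.size - lam.length) * (lam.numTableaux mu : ℚ) / (lam.hookProd : ℚ)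
            * lam.hookPowProd delta = P.eval (n : ℚ)) := by
  have hdelta := StrictPartition.hookPowProd_mem_degLE delta
  constructor
  · intro lam
    exact congrFun (StrictPartition.diffOp_iterate_div_hookProd
      (StrictPartition.mul_mem_degLE hdelta (StrictPartition.phi_mem_degLE nu))) lam
  · intro mu
    obtain ⟨P, hP, h⟩ := StrictPartition.exists_polynomial_sum_extensions
      (StrictPartition.diffOp_iterate_div_hookProd hdelta) mu
    refine ⟨P, hP, fun n => ?_⟩
    rw [← h n]
    exact Finset.sum_congr rfl fun lam _ => by ring
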